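/- Take the speed of light to be $1$. Let $f\in L^\infty(\mathbb R^3_x\times\mathbb R^3_p;\mathbb R)$ be non-negative with compact support (so $f\in L^1\cap L^\infty$); the time variable of $f$ is frozen. For $x\neq y$ in $\mathbb R^3$ write $\omega=\frac{y-x}{|y-x|}$, and for $A:\mathbb R^3\to\mathbb R^3$ put $$v_A(x,p)=\frac{p-A(x)}{\sqrt{1+|p-A(x)|^2}},\qquad \rho(x)=\int_{\mathbb R^3} f(x,p)\,dp,\qquad j_A(x)=\int_{\mathbb R^3} v_A(x,p)f(x,p)\,dp .$$ Then there is exactly one pair of bounded functions $\Phi:\mathbb R^3\to\mathbb R$, $A:\mathbb R^3\to\mathbb R^3$ such that for every $x\in\mathbb R^3$ (with absolutely convergent integrals) $$\Phi(x)=\int_{\mathbb R^3}\rho(y)\frac{dy}{|y-x|},\qquad A(x)=\frac12\int_{\mathbb R^3}\left[\mathrm{id}+\omega\otimes\omega\right]j_A(y)\frac{dy}{|y-x|}.$$ Moreover, $\Phi$ and $A$ are differentiable, and $\nabla\Phi$ and the matrix gradient $\partial_xA=(\partial_kA^i)_{k,i}$ (row index $k$, column index $i$) are continuous and bounded on $\mathbb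 R^3$; hence $f\,\nabla\Phi$ and $f\sum_{i}v_A^i\nabla A^i$ are in $L^1(\mathbb R^6;\mathbb R^3)$. In addition, for every $x\in\mathbb R^3$, $\nabla\cdot A(x)=\mathrm{Trace}(\partial_xA(x))=0$ and $$\partial_xA(x)=\frac12\int_{\mathbb R^3}\int_{\mathbb R^3}\Big\{\omega\otimes v_A-v_A\otimes\omega+\left[3\,\omega\otimes\omega-\mathrm{id}\right](v_A\cdot\omega)\Big\}f(y,p)\,\frac{dp\,dy}{|y-x|^2},$$ where $v_A=v_A(y,p)$, $(a\otimes b)_{ki}=a^kb^i$, and the integrals converge absolutely. -/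

import Mathlib

open MeasureTheory
open scoped ENNReal

namespace RVD

noncomputable section

/-- Euclidean three-space, used both for positions and for generalized momenta. -/
abbrev E3 : Type := EuclideanSpace ℝ (Fin 3)

/-- The map `z ↦ z / √(1 + |z|²)`. -/
def vel (z : E3) : E3 := (Real.sqrt (1 + ‖z‖ ^ 2))⁻¹ • z

/-- The relativistic velocity `v_A(x,p) = (p - A(x)) / √(1 + |p - A(x)|²)` (speed of light one). -/
def velA (A : E3 → E3) (x p : E3) : E3 := vel (p - A x)

/-- The charge density `ρ(x) = ∫ f(x,p) dp`. -/
def rho (f : E3 × E3 → ℝ) (x : E3) : ℝ := ∫ p, f (x, p)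

/-- The current density `j_A(x) = ∫ v_A(x,p) f(x,p) dp`. -/
def current (f : E3 × E3 → ℝ) (A : E3 → E3) (x : E3) : E3 := ∫ p, f (x, p) • velA A x p

/-- The unit vector `ω = (y - x) / |y - x|`. -/
def omega (x y : E3) : E3 := ‖y - x‖⁻¹ • (y - x)

/-- The vector `|y - x|⁻¹ [id + ω ⊗ ω] j`. -/
def darwinKernel (x y j : E3) : E3 :=
  ‖y - x‖⁻¹ • (j + inner ℝ (omega x y) j • omega x y)

/-- `Φ(x) = ∫ ρ(y) dy / |y - x|` for every `x`, the integral being absolutely convergent. -/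
def IsScalarPotential (f : E3 × E3 → ℝ) (Φ : E3 → ℝ) : Prop :=
  ∀ x, Integrable (fun y => rho f y / ‖y - x‖) ∧ Φ x = ∫ y, rho f y / ‖y - x‖

/-- `A(x) = ½ ∫ [id + ω ⊗ ω] j_A(y) dy / |y - x|` for every `x`, the integral being absolutely
convergent. -/
def IsVectorPotential (f : E3 × E3 → ℝ) (A : E3 → E3) : Prop :=
  ∀ x, Integrable (fun y => darwinKernel x y (current f A y)) ∧
    A x = (1 / 2 : ℝ) • ∫ y, darwinKernel x y (current f A y)

/-- `Φ` and `A` are bounded and solve the equations for the potentials induced by `f`. -/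
structure IsBoundedPotentials (f : E3 × E3 → ℝ) (Φ : E3 → ℝ) (A : E3 → E3) : Prop where
  scalar : IsScalarPotential f Φ
  vector : IsVectorPotential f A
  scalar_bdd : ∃ C : ℝ, ∀ x, |Φ x| ≤ C
  vector_bdd : ∃ C : ℝ, ∀ x, ‖A x‖ ≤ C

/-- The matrix gradient `∂ₓA`, with `(k, i)` entry `∂ₖ Aⁱ`: row `k` is the direction of
differentiation, column `i` the component. -/
def matrixGradient (A : E3 → E3) (x : E3) : Matrix (Fin 3) (Fin 3) ℝ :=
  Matrix.of fun k i => fderiv ℝ A x (EuclideanSpace.single k 1) i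

/-- The divergence `∑ᵢ ∂ᵢ Aⁱ`. -/
def divergence (A : E3 → E3) (x : E3) : ℝ :=
  ∑ i, fderiv ℝ (fun y => A y i) x (EuclideanSpace.single i 1)

/-- The tensor product `a ⊗ b`, with `(k, i)` entry `aᵏ bⁱ`. -/
def tensor (a b : E3) : Matrix (Fin 3) (Fin 3) ℝ := Matrix.of fun k i => a k * b i

/-- The matrix `ω ⊗ v - v ⊗ ω + [3 ω ⊗ ω - id] (v · ω)`. -/
def gradientMatrix (ω v : E3) : Matrix (Fin 3) (Fin 3) ℝ :=
  tensor ω v - tensor v ω + inner ℝ v ω • ((3 : ℝ) • tensor ω ω - 1)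

/-- The integrand of the formula for `∂ₓA(x)`, as a function of `(y, p)`. -/
def gradientIntegrand (f : E3 × E3 → ℝ) (A : E3 → E3) (x y p : E3) :
    Matrix (Fin 3) (Fin 3) ℝ :=
  (f (y, p) / ‖y - x‖ ^ 2) • gradientMatrix (omega x y) (velA A y p)

end

end RVD

namespace RVD

open Metric Filter Topology Set

/-! ### Local integrability of inverse-square singularities, uniformly under translation -/

section Newtonian

/-! The equation for `A` is a fixed point problem `A = T (N A)` on `L²` of a ball. Here `N` is the
local nonlinear map sending a potential to its current, and `T` is the linear Darwin operator
sending a current to its potential. No smallness of `f` is needed, because monotonicity replaces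
contraction.

The operator `T` is symmetric and positive semidefinite. The Darwin kernel is an integral over
scales `a` of the kernels `heatKernel a` (`integral_rpow_mul_heatKernel`). Each of these is, up to a
positive constant, the overlap integral of the curls of two Gaussian vector fields
(`integral_curlPairing`), so its quadratic form is the integral of a square
(`integral_inner_dipole_nonneg`).

The map `-N` is cocoercive: `‖N a - N b‖² ≤ -L ⟨N a - N b, a - b⟩`. This holds for the velocity map
`vel` with constant one (`norm_vel_sub_sq_le`) and survives averaging against `f(y, ·)`, with `L` a
bound for the charge density (`norm_integral_vel_sub_sq_le`).

Uniqueness: if `d` is the difference of the currents of two solutions, then `T d` is the difference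
of the potentials, so `‖d‖² ≤ -L ⟨d, T d⟩ ≤ 0`. Existence: the relaxed iteration `j ↦ (1 - ε) j + ε
N (T j)` contracts the energy `⟨T e, e⟩ + ‖e‖² / (2L)`, which is equivalent to `‖e‖²`
(`exists_fixedPoint_of_cocoercive`).

The densities are merely bounded, but the differentiated kernels have size `|z|⁻²`, which is locally
integrable. Replacing `|z|` by `√(|z|² + ε²)` changes the potentials and their derivatives by an
error tending to zero uniformly in `x`, which justifies differentiation under the integral
(`IsRegularization.hasFDerivAt_integral`). The gradient formula is then the derivative of the kernel
written out, and the divergence vanishes because that matrix has trace zero pointwise. -/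

lemma integrableOn_inv_sq : IntegrableOn (fun z : E3 => (‖z‖ ^ 2)⁻¹) (ball 0 1) := by
  have h := (integrableOn_fun_norm_addHaar (E := E3) volume (f := fun s : ℝ => (s ^ 2)⁻¹) (r := 1)).2
  apply h
  -- In polar coordinates the Jacobian `s²` of dimension three cancels the singularity exactly.
  have h1 : IntegrableOn (fun _ : ℝ => (1 : ℝ)) (Ioo 0 1) := by simp
  refine h1.congr_fun ?_ measurableSet_Ioo
  intro s hs
  have : s ≠ 0 := hs.1.ne'
  simp [this]

/-- The singular part of `H` is integrated over the whole space, where translation does not matter,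
and the rest is at most `c`. Hence the bound does not depend on `x`, which is what uniform estimates
of potentials require. -/
lemma setIntegral_translate_le {H : E3 → ℝ} {c : ℝ} (hm : Measurable H) (h0 : ∀ z, 0 ≤ H z)
    (hc : ∀ z, z ∉ ball (0 : E3) 1 → H z ≤ c) (hc0 : 0 ≤ c) (hi : IntegrableOn H (ball 0 1))
    (R : ℝ) (x : E3) :
    IntegrableOn (fun y => H (y - x)) (closedBall 0 R) ∧
      ∫ y in closedBall (0 : E3) R, H (y - x) ≤
        (∫ z in ball (0 : E3) 1, H z) + c * volume.real (closedBall (0 : E3) R) := by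
  have hi' : Integrable ((ball (0 : E3) 1).indicator H) :=
    (integrable_indicator_iff measurableSet_ball).2 hi
  have hi2 : Integrable (fun y => (ball (0 : E3) 1).indicator H (y - x)) := hi'.comp_sub_right x
  have hfin : volume (closedBall (0 : E3) R) < ∞ := measure_closedBall_lt_top
  have hcst : IntegrableOn (fun _ : E3 => c) (closedBall (0 : E3) R) := by
    rw [integrableOn_const_iff]; right; exact hfin
  have hle : ∀ y, H (y - x) ≤ (ball (0 : E3) 1).indicator H (y - x) + c := by
    intro y
    by_cases hy : y - x ∈ ball (0 : E3) 1
    · rw [indicator_of_mem hy]; linarith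
    · rw [indicator_of_notMem hy]; linarith [hc _ hy]
  have hint : IntegrableOn (fun y => H (y - x)) (closedBall 0 R) := by
    refine Integrable.mono' (hi2.integrableOn.add hcst) ?_ ?_
    · exact (hm.comp (measurable_id.sub_const x)).aestronglyMeasurable
    · refine Eventually.of_forall fun y => ?_
      rw [Real.norm_eq_abs, abs_of_nonneg (h0 _)]; exact hle y
  refine ⟨hint, ?_⟩
  calc ∫ y in closedBall (0 : E3) R, H (y - x)
      ≤ ∫ y in closedBall (0 : E3) R, ((ball (0 : E3) 1).indicator H (y - x) + c) :=
        integral_mono hint (hi2.integrableOn.add hcst) hle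
    _ = (∫ y in closedBall (0 : E3) R, (ball (0 : E3) 1).indicator H (y - x)) +
          c * volume.real (closedBall (0 : E3) R) := by
        rw [integral_add hi2.integrableOn hcst]; simp [mul_comm]
    _ ≤ (∫ y, (ball (0 : E3) 1).indicator H (y - x)) +
          c * volume.real (closedBall (0 : E3) R) := by
        have := setIntegral_le_integral (s := closedBall (0 : E3) R) hi2
          (Eventually.of_forall fun y => indicator_nonneg (fun z _ => h0 z) _)
        linarith
    _ = _ := by
        rw [integral_sub_right_eq_self (fun y => (ball (0 : E3) 1).indicator H y) x,
          integral_indicator measurableSet_ball]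

/-- The weight dominating the singular kernels. -/
noncomputable def weight (z : E3) : ℝ := 1 + (‖z‖ ^ 2)⁻¹

lemma weight_nonneg (z : E3) : 0 ≤ weight z := by unfold weight; positivity

lemma measurable_weight : Measurable weight := by unfold weight; fun_prop

lemma weight_le_two {z : E3} (hz : z ∉ ball (0 : E3) 1) : weight z ≤ 2 := by
  have : 1 ≤ ‖z‖ := by simpa using hz
  have h2 : (‖z‖ ^ 2)⁻¹ ≤ 1 := inv_le_one_of_one_le₀ (one_le_pow₀ this)
  unfold weight; linarith

lemma integrableOn_weight : IntegrableOn weight (ball 0 1) := by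
  have h1 : IntegrableOn (fun _ : E3 => (1 : ℝ)) (ball 0 1) := by
    rw [integrableOn_const_iff]; right; exact measure_ball_lt_top
  exact h1.add integrableOn_inv_sq

/-- A uniform bound for the integral of a translated weight over a ball. -/
noncomputable def weightBound (R : ℝ) : ℝ :=
  (∫ z in ball (0 : E3) 1, weight z) + 2 * volume.real (closedBall (0 : E3) R)

lemma integrableOn_weight_translate (R : ℝ) (x : E3) :
    IntegrableOn (fun y => weight (y - x)) (closedBall 0 R) :=
  (setIntegral_translate_le measurable_weight weight_nonneg (fun _ => weight_le_two) zero_le_two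
    integrableOn_weight R x).1

lemma setIntegral_weight_translate_le (R : ℝ) (x : E3) :
    ∫ y in closedBall (0 : E3) R, weight (y - x) ≤ weightBound R :=
  (setIntegral_translate_le measurable_weight weight_nonneg (fun _ => weight_le_two) zero_le_two
    integrableOn_weight R x).2

/-- The weight damped at distances larger than `ε`. -/
noncomputable def dampedWeight (ε : ℝ) (z : E3) : ℝ := weight z * min 1 (ε / ‖z‖)

lemma dampedWeight_nonneg {ε : ℝ} (hε : 0 ≤ ε) (z : E3) : 0 ≤ dampedWeight ε z := by
  unfold dampedWeight
  have := weight_nonneg z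
  have : 0 ≤ ε / ‖z‖ := by positivity
  positivity

lemma measurable_dampedWeight (ε : ℝ) : Measurable (dampedWeight ε) := by
  unfold dampedWeight
  exact measurable_weight.mul (measurable_const.min (measurable_const.div measurable_norm))

lemma dampedWeight_le_weight (ε : ℝ) (z : E3) : dampedWeight ε z ≤ weight z := by
  unfold dampedWeight
  exact mul_le_of_le_one_right (weight_nonneg z) (min_le_left _ _)

lemma dampedWeight_le {ε : ℝ} (hε : 0 ≤ ε) {z : E3} (hz : z ∉ ball (0 : E3) 1) :
    dampedWeight ε z ≤ 2 * ε := by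
  have h1 : 1 ≤ ‖z‖ := by simpa using hz
  unfold dampedWeight
  have h2 : min 1 (ε / ‖z‖) ≤ ε := (min_le_right _ _).trans (div_le_self hε h1)
  have h3 : 0 ≤ min 1 (ε / ‖z‖) := le_min zero_le_one (by positivity)
  exact mul_le_mul (weight_le_two hz) h2 h3 zero_le_two

lemma integrableOn_dampedWeight {ε : ℝ} (hε : 0 ≤ ε) :
    IntegrableOn (dampedWeight ε) (ball 0 1) := by
  refine Integrable.mono' integrableOn_weight (measurable_dampedWeight ε).aestronglyMeasurable ?_
  refine Eventually.of_forall fun z => ?_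
  rw [Real.norm_eq_abs, abs_of_nonneg (dampedWeight_nonneg hε z)]
  exact dampedWeight_le_weight ε z

/-- A uniform bound for the integral of a translated damped weight over a ball. -/
noncomputable def dampedBound (R ε : ℝ) : ℝ :=
  (∫ z in ball (0 : E3) 1, dampedWeight ε z) + 2 * ε * volume.real (closedBall (0 : E3) R)

lemma setIntegral_dampedWeight_translate_le {ε : ℝ} (hε : 0 ≤ ε) (R : ℝ) (x : E3) :
    IntegrableOn (fun y => dampedWeight ε (y - x)) (closedBall 0 R) ∧
    ∫ y in closedBall (0 : E3) R, dampedWeight ε (y - x) ≤ dampedBound R ε :=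
  setIntegral_translate_le (measurable_dampedWeight ε) (dampedWeight_nonneg hε)
    (fun _ => dampedWeight_le hε) (by positivity) (integrableOn_dampedWeight hε) R x

lemma tendsto_dampedWeight {u : ℕ → ℝ} (hu : Tendsto u atTop (𝓝 0)) (z : E3) :
    Tendsto (fun n => dampedWeight (u n) z) atTop (𝓝 0) := by
  have h : Tendsto (fun n => weight z * min 1 (u n / ‖z‖)) atTop
      (𝓝 (weight z * min 1 (0 / ‖z‖))) :=
    (tendsto_const_nhds.min (hu.div_const _)).const_mul _
  simpa [dampedWeight] using h

/-- Dominated convergence handles the unit ball, with `weight` as majorant; the contribution from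
outside is linear in the parameter. -/
lemma tendsto_dampedBound (R : ℝ) {u : ℕ → ℝ} (hu : Tendsto u atTop (𝓝 0)) (h0 : ∀ n, 0 ≤ u n) :
    Tendsto (fun n => dampedBound R (u n)) atTop (𝓝 0) := by
  have h1 : Tendsto (fun n => ∫ z in ball (0 : E3) 1, dampedWeight (u n) z) atTop
      (𝓝 (∫ z in ball (0 : E3) 1, (0 : ℝ))) := by
    refine tendsto_integral_of_dominated_convergence weight
      (fun n => (measurable_dampedWeight _).aestronglyMeasurable) integrableOn_weight ?_ ?_
    · intro n
      refine Eventually.of_forall fun z => ?_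
      rw [Real.norm_eq_abs, abs_of_nonneg (dampedWeight_nonneg (h0 n) z)]
      exact dampedWeight_le_weight _ z
    · exact Eventually.of_forall fun z => tendsto_dampedWeight hu z
  have h2 := h1.add ((hu.const_mul 2).mul_const (volume.real (closedBall (0 : E3) R)))
  simpa [dampedBound] using h2

end Newtonian

/-! ### Potentials of bounded densities with weakly singular kernels -/

section Families

variable {V F : Type*} [NormedAddCommGroup V] [NormedAddCommGroup F]

/-- Bounded measurable densities supported in a ball, up to null sets. -/
structure IsDensity (g : E3 → V) (R M : ℝ) : Prop where
  meas : AEStronglyMeasurable g volume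
  nonneg : 0 ≤ M
  bound : ∀ᵐ y, ‖g y‖ ≤ M
  supp : ∀ᵐ y, y ∉ closedBall (0 : E3) R → g y = 0

lemma IsDensity.norm_le {g : E3 → V} {R M : ℝ} (hg : IsDensity g R M) :
    ∀ᵐ y, ‖g y‖ ≤ (closedBall (0 : E3) R).indicator (fun _ => M) y := by
  filter_upwards [hg.bound, hg.supp] with y h1 h2
  by_cases hy : y ∈ closedBall (0 : E3) R
  · rwa [indicator_of_mem hy]
  · rw [indicator_of_notMem hy, h2 hy, norm_zero]

lemma IsDensity.integrable_norm {g : E3 → V} {R M : ℝ} (hg : IsDensity g R M) :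
    Integrable (fun y => ‖g y‖) := by
  have : Integrable ((closedBall (0 : E3) R).indicator (fun _ => M)) := by
    rw [integrable_indicator_iff measurableSet_closedBall, integrableOn_const_iff]
    right; exact measure_closedBall_lt_top
  refine Integrable.mono' this hg.meas.norm ?_
  filter_upwards [hg.norm_le] with y hy
  simpa using hy

/-- A family of continuous kernels `G ε`, `ε > 0`, approximating a weakly singular kernel `G 0`. -/
structure IsRegularization (G : ℝ → E3 → V → F) (C : ℝ) : Prop where
  nonneg : 0 ≤ C
  cont : ∀ ε > 0, Continuous (fun q : E3 × V => G ε q.1 q.2)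
  bdd : ∀ ε > 0, ∃ M, ∀ z v, ‖G ε z v‖ ≤ M * ‖v‖
  bound : ∀ z v, z ≠ 0 → ‖G 0 z v‖ ≤ C * ‖v‖ * weight z
  diff : ∀ ε > 0, ∀ z v, z ≠ 0 → ‖G ε z v - G 0 z v‖ ≤ C * ‖v‖ * dampedWeight ε z

/-- A sequence of positive parameters tending to zero. -/
lemma tendsto_one_div_succ : Tendsto (fun n : ℕ => 1 / ((n : ℝ) + 1)) atTop (𝓝 0) :=
  tendsto_one_div_add_atTop_nhds_zero_nat

lemma ae_sub_ne_zero (x : E3) : ∀ᵐ y : E3, y - x ≠ 0 := by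
  have : ∀ᵐ y : E3, y ≠ x := by simp [ae_iff]
  filter_upwards [this] with y hy using sub_ne_zero.2 hy

namespace IsRegularization

variable {G : ℝ → E3 → V → F} {C R M : ℝ} {g : E3 → V}

lemma aestronglyMeasurable (hG : IsRegularization G C) {ε : ℝ} (hε : 0 < ε) {μ : Measure E3}
    (hg : AEStronglyMeasurable g μ) (x : E3) :
    AEStronglyMeasurable (fun y => G ε (y - x) (g y)) μ := by
  have h1 : AEStronglyMeasurable (fun y : E3 => (y - x, g y)) μ :=
    ((continuous_id.sub continuous_const).aestronglyMeasurable).prodMk hg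
  exact (hG.cont ε hε).comp_aestronglyMeasurable h1

lemma tendsto (hG : IsRegularization G C) {z : E3} (hz : z ≠ 0) (v : V) :
    Tendsto (fun n : ℕ => G (1 / ((n : ℝ) + 1)) z v) atTop (𝓝 (G 0 z v)) := by
  rw [tendsto_iff_norm_sub_tendsto_zero]
  have h := (tendsto_dampedWeight tendsto_one_div_succ z).const_mul (C * ‖v‖)
  rw [mul_zero] at h
  exact squeeze_zero (fun n => norm_nonneg _)
    (fun n => hG.diff _ (by positivity) z v hz) h

/-- The singular kernel is an almost everywhere limit of the continuous kernels, so its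
measurability need not be assumed separately. -/
lemma aestronglyMeasurable_zero (hG : IsRegularization G C) {μ : Measure E3} (hμ : μ ≪ volume)
    (hg : AEStronglyMeasurable g μ) (x : E3) :
    AEStronglyMeasurable (fun y => G 0 (y - x) (g y)) μ := by
  refine aestronglyMeasurable_of_tendsto_ae atTop
    (f := fun (n : ℕ) y => G (1 / ((n : ℝ) + 1)) (y - x) (g y))
    (fun n => hG.aestronglyMeasurable (by positivity) hg x) ?_
  filter_upwards [hμ.ae_le (ae_sub_ne_zero x)] with y hy
  exact hG.tendsto hy _

lemma norm_le (hG : IsRegularization G C) (hg : IsDensity g R M) (x : E3) :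
    ∀ᵐ y, ‖G 0 (y - x) (g y)‖ ≤
      (closedBall (0 : E3) R).indicator (fun y => C * M * weight (y - x)) y := by
  filter_upwards [hg.norm_le, hg.supp, ae_sub_ne_zero x] with y h1 h2 h3
  have hb := hG.bound (y - x) (g y) h3
  have hw := weight_nonneg (y - x)
  have hC := hG.nonneg
  by_cases hy : y ∈ closedBall (0 : E3) R
  · rw [indicator_of_mem hy] at h1 ⊢
    exact hb.trans (by gcongr)
  · rw [indicator_of_notMem hy]
    rw [h2 hy] at hb ⊢
    simpa using hb

lemma norm_sub_le (hG : IsRegularization G C) (hg : IsDensity g R M) {ε : ℝ} (hε : 0 < ε)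
    (x : E3) :
    ∀ᵐ y, ‖G ε (y - x) (g y) - G 0 (y - x) (g y)‖ ≤
      (closedBall (0 : E3) R).indicator (fun y => C * M * dampedWeight ε (y - x)) y := by
  filter_upwards [hg.norm_le, hg.supp, ae_sub_ne_zero x] with y h1 h2 h3
  have hb := hG.diff ε hε (y - x) (g y) h3
  have hw := dampedWeight_nonneg hε.le (y - x)
  have hC := hG.nonneg
  by_cases hy : y ∈ closedBall (0 : E3) R
  · rw [indicator_of_mem hy] at h1 ⊢
    exact hb.trans (by gcongr)
  · rw [indicator_of_notMem hy]
    rw [h2 hy] at hb ⊢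
    simpa using hb

lemma integrable_zero (hG : IsRegularization G C) (hg : IsDensity g R M) (x : E3) :
    Integrable (fun y => G 0 (y - x) (g y)) := by
  refine Integrable.mono' ?_
    (hG.aestronglyMeasurable_zero Measure.AbsolutelyContinuous.rfl hg.meas x) (hG.norm_le hg x)
  rw [integrable_indicator_iff measurableSet_closedBall]
  exact (integrableOn_weight_translate R x).const_mul _

lemma integrable (hG : IsRegularization G C) (hg : IsDensity g R M) {ε : ℝ} (hε : 0 < ε)
    (x : E3) : Integrable (fun y => G ε (y - x) (g y)) := by
  obtain ⟨M', hM'⟩ := hG.bdd ε hε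
  refine Integrable.mono' (hg.integrable_norm.const_mul M')
    (hG.aestronglyMeasurable hε hg.meas x) (Eventually.of_forall fun y => hM' _ _)

variable [NormedSpace ℝ F]

lemma norm_integral_le (hG : IsRegularization G C) (hg : IsDensity g R M) (x : E3) :
    ‖∫ y, G 0 (y - x) (g y)‖ ≤ C * M * weightBound R := by
  have hi : Integrable ((closedBall (0 : E3) R).indicator
      (fun y => C * M * weight (y - x))) := by
    rw [integrable_indicator_iff measurableSet_closedBall]
    exact (integrableOn_weight_translate R x).const_mul _
  refine (norm_integral_le_of_norm_le hi (hG.norm_le hg x)).trans ?_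
  rw [integral_indicator measurableSet_closedBall, integral_const_mul]
  have := hG.nonneg
  have := hg.nonneg
  gcongr
  exact setIntegral_weight_translate_le R x

lemma norm_integral_sub_le (hG : IsRegularization G C) (hg : IsDensity g R M) {ε : ℝ}
    (hε : 0 < ε) (x : E3) :
    ‖(∫ y, G ε (y - x) (g y)) - ∫ y, G 0 (y - x) (g y)‖ ≤ C * M * dampedBound R ε := by
  rw [← integral_sub (hG.integrable hg hε x) (hG.integrable_zero hg x)]
  have hi : Integrable ((closedBall (0 : E3) R).indicator
      (fun y => C * M * dampedWeight ε (y - x))) := by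
    rw [integrable_indicator_iff measurableSet_closedBall]
    exact (setIntegral_dampedWeight_translate_le hε.le R x).1.const_mul _
  refine (norm_integral_le_of_norm_le hi (hG.norm_sub_le hg hε x)).trans ?_
  rw [integral_indicator measurableSet_closedBall, integral_const_mul]
  have := hG.nonneg
  have := hg.nonneg
  gcongr
  exact (setIntegral_dampedWeight_translate_le hε.le R x).2

/-- The error is at most `C * M * dampedBound R ε`, in which `x` does not occur. -/
lemma tendstoUniformly (hG : IsRegularization G C) (hg : IsDensity g R M) :
    TendstoUniformly (fun (n : ℕ) x => ∫ y, G (1 / ((n : ℝ) + 1)) (y - x) (g y))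
      (fun x => ∫ y, G 0 (y - x) (g y)) atTop := by
  rw [Metric.tendstoUniformly_iff]
  intro δ hδ
  have h := (tendsto_dampedBound R tendsto_one_div_succ (fun n => by positivity)).const_mul (C * M)
  rw [mul_zero] at h
  filter_upwards [h.eventually (gt_mem_nhds hδ)] with n hn x
  rw [dist_comm, dist_eq_norm]
  exact (hG.norm_integral_sub_le hg (by positivity) x).trans_lt hn

lemma continuous_integral (hG : IsRegularization G C) (hg : IsDensity g R M) {ε : ℝ}
    (hε : 0 < ε) : Continuous (fun x => ∫ y, G ε (y - x) (g y)) := by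
  obtain ⟨M', hM'⟩ := hG.bdd ε hε
  refine continuous_of_dominated (fun x => hG.aestronglyMeasurable hε hg.meas x)
    (fun x => Eventually.of_forall fun y => hM' _ _) (hg.integrable_norm.const_mul M') ?_
  refine Eventually.of_forall fun y => ?_
  exact (hG.cont ε hε).comp ((continuous_const.sub continuous_id).prodMk continuous_const)

lemma continuous_integral_zero (hG : IsRegularization G C) (hg : IsDensity g R M) :
    Continuous (fun x => ∫ y, G 0 (y - x) (g y)) :=
  (hG.tendstoUniformly hg).continuous
    (Frequently.of_forall fun n => hG.continuous_integral hg (by positivity))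

/-- Differentiation of a potential with weakly singular kernel under the integral sign. -/
lemma hasFDerivAt_integral (hG : IsRegularization G C) {G' : ℝ → E3 → V → (E3 →L[ℝ] F)} {C' : ℝ}
    (hG' : IsRegularization G' C')
    (hd : ∀ ε > 0, ∀ z v, HasFDerivAt (fun z => G ε z v) (G' ε z v) z)
    (hg : IsDensity g R M) (x : E3) :
    HasFDerivAt (fun x => ∫ y, G 0 (y - x) (g y)) (-∫ y, G' 0 (y - x) (g y)) x := by
  -- Uniform convergence of the derivatives and pointwise convergence of the potentials suffice to
  -- pass to the limit. The sign comes from the chain rule for `x ↦ y - x`.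
  have hu := (hG'.tendstoUniformly hg).neg
  refine hasFDerivAt_of_tendstoUniformly (l := atTop)
    (f := fun (n : ℕ) x => ∫ y, G (1 / ((n : ℝ) + 1)) (y - x) (g y)) hu ?_
    (fun x => (hG.tendstoUniformly hg).tendsto_at x) x
  intro n x
  have hε : 0 < 1 / ((n : ℝ) + 1) := by positivity
  obtain ⟨M', hM'⟩ := hG'.bdd _ hε
  simp only [Pi.neg_apply]
  rw [← integral_neg]
  refine hasFDerivAt_integral_of_dominated_of_fderiv_le (s := univ)
    (F' := fun x y => -G' (1 / ((n : ℝ) + 1)) (y - x) (g y)) univ_mem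
    (Eventually.of_forall fun x => hG.aestronglyMeasurable hε hg.meas x)
    (hG.integrable hg hε x) (hG'.aestronglyMeasurable hε hg.meas x).neg ?_
    (hg.integrable_norm.const_mul M') ?_
  · refine Eventually.of_forall fun y x _ => ?_
    rw [norm_neg]; exact hM' _ _
  · refine Eventually.of_forall fun y x _ => ?_
    have h1 : HasFDerivAt (fun x : E3 => y - x) (-ContinuousLinearMap.id ℝ E3) x :=
      (hasFDerivAt_id x).const_sub y
    have h2 := (hd _ hε (y - x) (g y)).comp x h1
    exact h2.congr_fderiv (ContinuousLinearMap.ext fun w =>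
      map_neg (G' (1 / ((n : ℝ) + 1)) (y - x) (g y)) w)

end IsRegularization

end Families

/-! ### The Coulomb and Darwin kernels, their derivatives and regularizations -/

section Kernels

/-- The regularized inverse distance `(|z|² + ε²)^(-1/2)`. -/
noncomputable def invDist (ε : ℝ) (z : E3) : ℝ := (√(‖z‖ ^ 2 + ε ^ 2))⁻¹

lemma invDist_zero (z : E3) : invDist 0 z = ‖z‖⁻¹ := by
  simp [invDist, Real.sqrt_sq (norm_nonneg z)]

lemma invDist_nonneg (ε : ℝ) (z : E3) : 0 ≤ invDist ε z := by unfold invDist; positivity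

lemma norm_mul_invDist_le (ε : ℝ) (z : E3) : ‖z‖ * invDist ε z ≤ 1 := by
  unfold invDist
  refine mul_inv_le_one_of_le₀ ?_ (Real.sqrt_nonneg _)
  exact Real.le_sqrt_of_sq_le (by nlinarith [sq_nonneg ε])

lemma invDist_le {ε : ℝ} (hε : 0 < ε) (z : E3) : invDist ε z ≤ ε⁻¹ := by
  unfold invDist
  gcongr
  exact Real.le_sqrt_of_sq_le (by nlinarith [sq_nonneg ‖z‖])

lemma continuous_invDist {ε : ℝ} (hε : 0 < ε) : Continuous (invDist ε) := by
  unfold invDist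
  refine Continuous.inv₀ (by fun_prop) fun z => ?_
  positivity

lemma hasFDerivAt_invDist {ε : ℝ} (hε : 0 < ε) (z : E3) :
    HasFDerivAt (invDist ε) (-(invDist ε z ^ 3) • innerSL ℝ z) z := by
  have h0 : 0 < ‖z‖ ^ 2 + ε ^ 2 := by positivity
  have h1 : HasFDerivAt (fun z : E3 => ‖z‖ ^ 2 + ε ^ 2) (2 • innerSL ℝ z) z :=
    (HasStrictFDerivAt.hasFDerivAt (hasStrictFDerivAt_norm_sq z)).add_const _
  have h2 := h1.sqrt h0.ne'
  have h3 := (hasDerivAt_inv (Real.sqrt_pos.2 h0).ne').comp_hasFDerivAt z h2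
  refine h3.congr_fderiv ?_
  ext w
  simp only [invDist, smul_apply, smul_eq_mul, innerSL_apply_apply]
  have : √(‖z‖ ^ 2 + ε ^ 2) ≠ 0 := (Real.sqrt_pos.2 h0).ne'
  field_simp
  simp

/-- With `t = ‖z‖ / √(‖z‖² + ε²)` in `[0, 1]`, Bernoulli gives `1 - t ^ k ≤ k (1 - t)`, and `1 - t ≤
min 1 (ε / ‖z‖)` because the root is at most `‖z‖ + ε`. -/
lemma abs_invDist_pow_sub_le {ε : ℝ} (hε : 0 < ε) {z : E3} (hz : z ≠ 0) (k : ℕ) :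
    |invDist ε z ^ k - (‖z‖⁻¹) ^ k| ≤ k * min 1 (ε / ‖z‖) * (‖z‖⁻¹) ^ k := by
  have hs : 0 < ‖z‖ := norm_pos_iff.2 hz
  set t := ‖z‖ * invDist ε z with ht
  have ht0 : 0 ≤ t := mul_nonneg hs.le (invDist_nonneg _ _)
  have ht1 : t ≤ 1 := norm_mul_invDist_le ε z
  have hinv : invDist ε z = t * ‖z‖⁻¹ := by rw [ht]; field_simp
  have h1 : 1 - t ≤ min 1 (ε / ‖z‖) := by
    refine le_min (by linarith) ?_
    have hr0 : 0 < √(‖z‖ ^ 2 + ε ^ 2) := Real.sqrt_pos.2 (by positivity)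
    have hr : √(‖z‖ ^ 2 + ε ^ 2) ≤ ‖z‖ + ε :=
      Real.sqrt_le_iff.2 ⟨by positivity, by nlinarith⟩
    have hr2 : ‖z‖ ≤ √(‖z‖ ^ 2 + ε ^ 2) := Real.le_sqrt_of_sq_le (by nlinarith)
    have : 1 - t = (√(‖z‖ ^ 2 + ε ^ 2) - ‖z‖) / √(‖z‖ ^ 2 + ε ^ 2) := by
      rw [ht, invDist]; field_simp
    rw [this]
    exact div_le_div₀ hε.le (by linarith) hs hr2
  have h2 : 1 - t ^ k ≤ k * (1 - t) := by
    have := one_add_mul_le_pow (a := t - 1) (by linarith) k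
    have h3 : 1 + (t - 1) = t := by ring
    rw [h3] at this
    linarith
  have h3 : t ^ k ≤ 1 := pow_le_one₀ ht0 ht1
  rw [hinv, mul_pow, ← sub_one_mul, abs_mul, abs_of_nonneg (a := (‖z‖⁻¹) ^ k) (by positivity),
    abs_sub_comm, abs_of_nonneg (by linarith)]
  gcongr
  exact h2.trans (by gcongr)

lemma inv_norm_le_weight (z : E3) : ‖z‖⁻¹ ≤ weight z := by
  unfold weight
  rw [← inv_pow]
  nlinarith [sq_nonneg (‖z‖⁻¹ - 1), inv_nonneg.2 (norm_nonneg z)]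

lemma inv_norm_sq_le_weight (z : E3) : ‖z‖⁻¹ ^ 2 ≤ weight z := by
  unfold weight; rw [inv_pow]; linarith

/-- The kernel `α v + β ⟨z, v⟩ z`. -/
noncomputable def dipole (α β : ℝ) (z v : E3) : E3 := α • v + (β * inner ℝ z v) • z

lemma norm_dipole_le (α β : ℝ) (z v : E3) :
    ‖dipole α β z v‖ ≤ (|α| + |β| * ‖z‖ ^ 2) * ‖v‖ := by
  unfold dipole
  refine (norm_add_le _ _).trans ?_
  rw [norm_smul, norm_smul, norm_mul, Real.norm_eq_abs, Real.norm_eq_abs]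
  have := norm_inner_le_norm (𝕜 := ℝ) z v
  calc |α| * ‖v‖ + |β| * ‖(inner ℝ z v : ℝ)‖ * ‖z‖
      ≤ |α| * ‖v‖ + |β| * (‖z‖ * ‖v‖) * ‖z‖ := by gcongr
    _ = _ := by ring

lemma dipole_sub (α β α' β' : ℝ) (z v : E3) :
    dipole α β z v - dipole α' β' z v = dipole (α - α') (β - β') z v := by
  unfold dipole; module

/-- The derivative in `z` of kernels of the form `dipole`. -/
noncomputable def dipoleDeriv (α β : ℝ) (z v : E3) : E3 →L[ℝ] E3 :=
  (-α) • (innerSL ℝ z).smulRight v + α • (innerSL ℝ v).smulRight z +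
    (α * inner ℝ z v) • ContinuousLinearMap.id ℝ E3 -
    (3 * β * inner ℝ z v) • (innerSL ℝ z).smulRight z

lemma dipoleDeriv_apply (α β : ℝ) (z v h : E3) :
    dipoleDeriv α β z v h = (-α * inner ℝ z h) • v + (α * inner ℝ v h) • z +
      (α * inner ℝ z v) • h - (3 * β * inner ℝ z v * inner ℝ z h) • z := by
  simp [dipoleDeriv, smul_smul]

lemma norm_dipoleDeriv_le (α β : ℝ) (z v : E3) :
    ‖dipoleDeriv α β z v‖ ≤ (3 * |α| * ‖z‖ + 3 * |β| * ‖z‖ ^ 3) * ‖v‖ := by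
  refine ContinuousLinearMap.opNorm_le_bound _ (by positivity) fun h => ?_
  rw [dipoleDeriv_apply]
  have h1 := norm_inner_le_norm (𝕜 := ℝ) z h
  have h2 := norm_inner_le_norm (𝕜 := ℝ) v h
  have h3 := norm_inner_le_norm (𝕜 := ℝ) z v
  refine (norm_sub_le _ _).trans ((add_le_add_left norm_add₃_le _).trans ?_)
  simp only [norm_smul, norm_mul, norm_neg, Real.norm_eq_abs] at *
  rw [abs_of_nonneg (a := (3 : ℝ)) (by norm_num)]
  calc |α| * |inner ℝ z h| * ‖v‖ + |α| * |inner ℝ v h| * ‖z‖ + |α| * |inner ℝ z v| * ‖h‖ +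
        3 * |β| * |inner ℝ z v| * |inner ℝ z h| * ‖z‖
      ≤ |α| * (‖z‖ * ‖h‖) * ‖v‖ + |α| * (‖v‖ * ‖h‖) * ‖z‖ + |α| * (‖z‖ * ‖v‖) * ‖h‖ +
        3 * |β| * (‖z‖ * ‖v‖) * (‖z‖ * ‖h‖) * ‖z‖ := by gcongr
    _ = _ := by ring

lemma dipoleDeriv_sub (α β α' β' : ℝ) (z v : E3) :
    dipoleDeriv α β z v - dipoleDeriv α' β' z v = dipoleDeriv (α - α') (β - β') z v := by
  ext1 h
  simp only [sub_apply, dipoleDeriv_apply]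
  module

lemma isRegularization_coulomb :
    IsRegularization (fun ε (z : E3) (v : ℝ) => v * invDist ε z) 1 where
  nonneg := zero_le_one
  cont ε hε := by
    have := continuous_invDist hε
    fun_prop
  bdd ε hε := ⟨ε⁻¹, fun z v => by
    rw [norm_mul, mul_comm, Real.norm_of_nonneg (invDist_nonneg _ _)]
    gcongr
    exact invDist_le hε z⟩
  bound z v hz := by
    rw [norm_mul, Real.norm_of_nonneg (invDist_nonneg _ _), one_mul, invDist_zero]
    gcongr
    exact inv_norm_le_weight z
  diff ε hε z v hz := by
    have h := abs_invDist_pow_sub_le hε hz 1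
    rw [← mul_sub, norm_mul, one_mul, Real.norm_eq_abs (_ - _), invDist_zero, dampedWeight]
    simp only [pow_one, Nat.cast_one, one_mul] at h
    have h0 : 0 ≤ min 1 (ε / ‖z‖) := by positivity
    gcongr
    refine h.trans ?_
    rw [mul_comm]
    gcongr
    exact inv_norm_le_weight z

lemma isRegularization_coulombDeriv :
    IsRegularization (fun ε (z : E3) (v : ℝ) => (-(v * invDist ε z ^ 3)) • innerSL ℝ z) 3 where
  nonneg := by norm_num
  cont ε hε := by
    have := continuous_invDist hε
    fun_prop
  bdd ε hε := ⟨ε⁻¹ ^ 2, fun z v => by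
    have h0 := invDist_nonneg ε z
    rw [norm_smul, norm_neg, norm_mul, innerSL_apply_norm, norm_pow, Real.norm_of_nonneg h0]
    calc ‖v‖ * invDist ε z ^ 3 * ‖z‖ = (‖z‖ * invDist ε z) * invDist ε z ^ 2 * ‖v‖ := by ring
      _ ≤ 1 * ε⁻¹ ^ 2 * ‖v‖ := by
        gcongr
        · exact norm_mul_invDist_le ε z
        · exact invDist_le hε z
      _ = _ := by ring⟩
  bound z v hz := by
    have hs : ‖z‖ ≠ 0 := norm_ne_zero_iff.2 hz
    rw [norm_smul, norm_neg, norm_mul, innerSL_apply_norm, norm_pow, invDist_zero, norm_inv,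
      norm_norm]
    calc ‖v‖ * ‖z‖⁻¹ ^ 3 * ‖z‖ = ‖v‖ * ‖z‖⁻¹ ^ 2 := by field_simp
      _ ≤ ‖v‖ * weight z := by gcongr; exact inv_norm_sq_le_weight z
      _ ≤ 3 * ‖v‖ * weight z := by
        have := weight_nonneg z
        nlinarith [mul_nonneg (norm_nonneg v) this]
  diff ε hε z v hz := by
    have hs : ‖z‖ ≠ 0 := norm_ne_zero_iff.2 hz
    have h := abs_invDist_pow_sub_le hε hz 3
    have h0 : 0 ≤ min 1 (ε / ‖z‖) := by positivity
    rw [← sub_smul, norm_smul, innerSL_apply_norm, invDist_zero, dampedWeight]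
    have e : -(v * invDist ε z ^ 3) - -(v * ‖z‖⁻¹ ^ 3) =
      -(v * (invDist ε z ^ 3 - ‖z‖⁻¹ ^ 3)) := by ring
    rw [e, norm_neg, norm_mul, Real.norm_eq_abs (_ - _)]
    calc ‖v‖ * |invDist ε z ^ 3 - ‖z‖⁻¹ ^ 3| * ‖z‖
        ≤ ‖v‖ * ((3 : ℕ) * min 1 (ε / ‖z‖) * ‖z‖⁻¹ ^ 3) * ‖z‖ := by gcongr
      _ = 3 * ‖v‖ * (‖z‖⁻¹ ^ 2 * min 1 (ε / ‖z‖)) := by push_cast; field_simp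
      _ ≤ _ := by gcongr; exact inv_norm_sq_le_weight z

lemma hasFDerivAt_coulomb {ε : ℝ} (hε : 0 < ε) (z : E3) (v : ℝ) :
    HasFDerivAt (fun z : E3 => v * invDist ε z) ((-(v * invDist ε z ^ 3)) • innerSL ℝ z) z := by
  refine ((hasFDerivAt_invDist hε z).const_mul v).congr_fderiv ?_
  rw [smul_smul]; congr 1; ring

lemma isRegularization_dipole :
    IsRegularization (fun ε (z v : E3) => dipole (invDist ε z) (invDist ε z ^ 3) z v) 4 where
  nonneg := by norm_num
  cont ε hε := by
    have := continuous_invDist hε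
    unfold dipole
    fun_prop
  bdd ε hε := ⟨2 * ε⁻¹, fun z v => by
    have h0 := invDist_nonneg ε z
    refine (norm_dipole_le _ _ _ _).trans ?_
    rw [abs_pow, abs_of_nonneg h0]
    gcongr
    have h1 := norm_mul_invDist_le ε z
    have h2 : (‖z‖ * invDist ε z) ^ 2 ≤ 1 := pow_le_one₀ (by positivity) h1
    calc invDist ε z + invDist ε z ^ 3 * ‖z‖ ^ 2
        = invDist ε z + invDist ε z * (‖z‖ * invDist ε z) ^ 2 := by ring
      _ ≤ ε⁻¹ + ε⁻¹ * 1 := by gcongr <;> exact invDist_le hε z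
      _ = _ := by ring⟩
  bound z v hz := by
    have hs : ‖z‖ ≠ 0 := norm_ne_zero_iff.2 hz
    refine (norm_dipole_le _ _ _ _).trans ?_
    rw [invDist_zero, abs_pow, abs_inv, abs_norm]
    have h1 := inv_norm_le_weight z
    have h2 : ‖z‖⁻¹ + ‖z‖⁻¹ ^ 3 * ‖z‖ ^ 2 = 2 * ‖z‖⁻¹ := by field_simp; norm_num
    rw [h2]
    have := weight_nonneg z
    nlinarith [norm_nonneg v, mul_nonneg (norm_nonneg v) this]
  diff ε hε z v hz := by
    have hs : ‖z‖ ≠ 0 := norm_ne_zero_iff.2 hz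
    have h0 : 0 ≤ min 1 (ε / ‖z‖) := by positivity
    have h1 := abs_invDist_pow_sub_le hε hz 1
    have h3 := abs_invDist_pow_sub_le hε hz 3
    simp only [pow_one, Nat.cast_one, one_mul] at h1
    rw [dipole_sub, invDist_zero, dampedWeight]
    refine (norm_dipole_le _ _ _ _).trans ?_
    calc (|invDist ε z - ‖z‖⁻¹| + |invDist ε z ^ 3 - ‖z‖⁻¹ ^ 3| * ‖z‖ ^ 2) * ‖v‖
        ≤ (min 1 (ε / ‖z‖) * ‖z‖⁻¹ + ((3 : ℕ) * min 1 (ε / ‖z‖) * ‖z‖⁻¹ ^ 3) * ‖z‖ ^ 2) * ‖v‖ := by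
          gcongr
      -- The constant is `4 = 1 + 3`, the sum of the exponents of the inverse distance.
      _ = 4 * ‖v‖ * (‖z‖⁻¹ * min 1 (ε / ‖z‖)) := by push_cast; field_simp; ring
      _ ≤ _ := by gcongr; exact inv_norm_le_weight z

lemma isRegularization_dipoleDeriv :
    IsRegularization
      (fun ε (z v : E3) => dipoleDeriv (invDist ε z ^ 3) (invDist ε z ^ 5) z v) 24 where
  nonneg := by norm_num
  cont ε hε := by
    have := continuous_invDist hε
    unfold dipoleDeriv
    have h (f g : E3 × E3 → E3) (hf : Continuous f) (hg : Continuous g) :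
        Continuous fun q => (innerSL ℝ (f q)).smulRight (g q) :=
      ((ContinuousLinearMap.smulRightL ℝ E3 E3).continuous₂).comp
        (((innerSL ℝ).continuous.comp hf).prodMk hg)
    have h1 := h _ _ continuous_fst continuous_snd
    have h2 := h _ _ continuous_snd continuous_fst
    have h3 := h _ _ continuous_fst continuous_fst
    fun_prop
  bdd ε hε := ⟨6 * ε⁻¹ ^ 2, fun z v => by
    have h0 := invDist_nonneg ε z
    refine (norm_dipoleDeriv_le _ _ _ _).trans ?_
    rw [abs_pow, abs_pow, abs_of_nonneg h0]
    gcongr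
    have h1 := norm_mul_invDist_le ε z
    have h2 : (‖z‖ * invDist ε z) ^ 3 ≤ 1 := pow_le_one₀ (by positivity) h1
    have h3 := invDist_le hε z
    calc 3 * invDist ε z ^ 3 * ‖z‖ + 3 * invDist ε z ^ 5 * ‖z‖ ^ 3
        = 3 * invDist ε z ^ 2 * (‖z‖ * invDist ε z) +
          3 * invDist ε z ^ 2 * (‖z‖ * invDist ε z) ^ 3 := by ring
      _ ≤ 3 * ε⁻¹ ^ 2 * 1 + 3 * ε⁻¹ ^ 2 * 1 := by gcongr
      _ = _ := by ring⟩
  bound z v hz := by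
    have hs : ‖z‖ ≠ 0 := norm_ne_zero_iff.2 hz
    refine (norm_dipoleDeriv_le _ _ _ _).trans ?_
    rw [invDist_zero, abs_pow, abs_pow, abs_inv, abs_norm]
    have h1 := inv_norm_sq_le_weight z
    have h2 : 3 * ‖z‖⁻¹ ^ 3 * ‖z‖ + 3 * ‖z‖⁻¹ ^ 5 * ‖z‖ ^ 3 = 6 * ‖z‖⁻¹ ^ 2 := by
      field_simp; norm_num
    rw [h2]
    have := weight_nonneg z
    nlinarith [norm_nonneg v, mul_nonneg (norm_nonneg v) this]
  diff ε hε z v hz := by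
    have hs : ‖z‖ ≠ 0 := norm_ne_zero_iff.2 hz
    have h0 : 0 ≤ min 1 (ε / ‖z‖) := by positivity
    have h3 := abs_invDist_pow_sub_le hε hz 3
    have h5 := abs_invDist_pow_sub_le hε hz 5
    rw [dipoleDeriv_sub, invDist_zero, dampedWeight]
    refine (norm_dipoleDeriv_le _ _ _ _).trans ?_
    calc (3 * |invDist ε z ^ 3 - ‖z‖⁻¹ ^ 3| * ‖z‖ +
          3 * |invDist ε z ^ 5 - ‖z‖⁻¹ ^ 5| * ‖z‖ ^ 3) * ‖v‖
        ≤ (3 * ((3 : ℕ) * min 1 (ε / ‖z‖) * ‖z‖⁻¹ ^ 3) * ‖z‖ +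
          3 * ((5 : ℕ) * min 1 (ε / ‖z‖) * ‖z‖⁻¹ ^ 5) * ‖z‖ ^ 3) * ‖v‖ := by
          gcongr
      -- The constant is `24 = 3 * 3 + 3 * 5`: prefactors from `norm_dipoleDeriv_le` times
      -- exponents.
      _ = 24 * ‖v‖ * (‖z‖⁻¹ ^ 2 * min 1 (ε / ‖z‖)) := by push_cast; field_simp; ring
      _ ≤ _ := by gcongr; exact inv_norm_sq_le_weight z

/-- For `s = invDist ε` one has `∇s = -s³ z`, so differentiation turns the coefficients `s, s³` into
`s³, s⁵`. This is why the two coefficients of `dipoleDeriv` are shifted relative to those of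
`dipole`. -/
lemma hasFDerivAt_dipole {ε : ℝ} (hε : 0 < ε) (z v : E3) :
    HasFDerivAt (fun z => dipole (invDist ε z) (invDist ε z ^ 3) z v)
      (dipoleDeriv (invDist ε z ^ 3) (invDist ε z ^ 5) z v) z := by
  have h1 := hasFDerivAt_invDist hε z
  have h2 : HasFDerivAt (fun z : E3 => (inner ℝ z v : ℝ)) (innerSL ℝ v) z := by
    have := (innerSL ℝ v).hasFDerivAt (x := z)
    refine this.congr_of_eventuallyEq (Eventually.of_forall fun w => ?_)
    simp [real_inner_comm]
  have h3 := (h1.smul_const v).add (((h1.pow 3).mul h2).smul (hasFDerivAt_id z))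
  refine h3.congr_fderiv ?_
  ext1 h
  simp [dipoleDeriv_apply, ContinuousLinearMap.smulRight_apply]
  module

end Kernels

/-! ### Gaussian moments and the overlap of Gaussian magnetic fields -/

section Gaussian

/-- The Gaussian `exp (-b |w|²)`. -/
noncomputable def gauss (b : ℝ) (w : E3) : ℝ := Real.exp (-b * ‖w‖ ^ 2)

lemma gauss_pos (b : ℝ) (w : E3) : 0 < gauss b w := Real.exp_pos _

lemma gauss_neg (b : ℝ) (w : E3) : gauss b (-w) = gauss b w := by simp [gauss]

lemma continuous_gauss (b : ℝ) : Continuous (gauss b) := by unfold gauss; fun_prop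

lemma gauss_le_one {b : ℝ} (hb : 0 ≤ b) (w : E3) : gauss b w ≤ 1 :=
  Real.exp_le_one_iff.2 (by rw [neg_mul]; exact neg_nonpos.2 (by positivity))

lemma integral_gauss_pos {b : ℝ} (hb : 0 < b) : 0 < ∫ w, gauss b w := by
  unfold gauss
  rw [GaussianFourier.integral_rexp_neg_mul_sq_norm hb]
  positivity

/-- A nonintegrable function has Bochner integral zero, so a positive integral already proves
integrability. -/
lemma integrable_gauss {b : ℝ} (hb : 0 < b) : Integrable (gauss b) :=
  Integrable.of_integral_ne_zero (integral_gauss_pos hb).ne'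

/-- Half of the decay rate pays for the polynomial factor, by `x * exp (-x) ≤ 1`. -/
lemma norm_sq_mul_gauss_le {b : ℝ} (hb : 0 < b) (w : E3) :
    ‖w‖ ^ 2 * gauss b w ≤ 2 / b * gauss (b / 2) w := by
  have h1 : gauss b w = gauss (b / 2) w * gauss (b / 2) w := by
    unfold gauss; rw [← Real.exp_add]; ring_nf
  have h2 : b / 2 * ‖w‖ ^ 2 * gauss (b / 2) w ≤ 1 := by
    unfold gauss
    rw [neg_mul, Real.exp_neg, ← div_eq_mul_inv, div_le_one (Real.exp_pos _)]
    linarith [Real.add_one_le_exp (b / 2 * ‖w‖ ^ 2)]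
  have h3 : ‖w‖ ^ 2 * gauss (b / 2) w ≤ 2 / b := by
    rw [le_div_iff₀ hb]; linarith
  rw [h1, ← mul_assoc]
  exact mul_le_mul_of_nonneg_right h3 (gauss_pos _ _).le

lemma integrable_norm_sq_mul_gauss {b : ℝ} (hb : 0 < b) :
    Integrable (fun w => ‖w‖ ^ 2 * gauss b w) := by
  refine Integrable.mono' ((integrable_gauss (half_pos hb)).const_mul (2 / b)) ?_ ?_
  · exact ((continuous_norm.pow 2).mul (continuous_gauss b)).aestronglyMeasurable
  · refine Eventually.of_forall fun w => ?_
    rw [Real.norm_of_nonneg (mul_nonneg (by positivity) (gauss_pos _ _).le)]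
    exact norm_sq_mul_gauss_le hb w

lemma integrable_inner_mul_inner_mul_gauss {b : ℝ} (hb : 0 < b) (u v : E3) :
    Integrable (fun w => inner ℝ w u * inner ℝ w v * gauss b w) := by
  refine Integrable.mono' ((integrable_norm_sq_mul_gauss hb).const_mul (‖u‖ * ‖v‖)) ?_ ?_
  · have := continuous_gauss b
    exact Continuous.aestronglyMeasurable (by fun_prop)
  · refine Eventually.of_forall fun w => ?_
    rw [norm_mul, norm_mul, Real.norm_of_nonneg (gauss_pos _ _).le, ← mul_assoc]
    have h1 := norm_inner_le_norm (𝕜 := ℝ) w u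
    have h2 := norm_inner_le_norm (𝕜 := ℝ) w v
    refine mul_le_mul_of_nonneg_right ?_ (gauss_pos _ _).le
    calc ‖(inner ℝ w u : ℝ)‖ * ‖(inner ℝ w v : ℝ)‖ ≤ (‖w‖ * ‖u‖) * (‖w‖ * ‖v‖) := by gcongr
      _ = _ := by ring

lemma integrable_inner_mul_gauss {b : ℝ} (hb : 0 < b) (u : E3) :
    Integrable (fun w => inner ℝ w u * gauss b w) := by
  refine Integrable.mono' (((integrable_gauss hb).add
    (integrable_norm_sq_mul_gauss hb)).const_mul ‖u‖) ?_ ?_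
  · have := continuous_gauss b
    exact Continuous.aestronglyMeasurable (by fun_prop)
  · refine Eventually.of_forall fun w => ?_
    have h0 := (gauss_pos b w).le
    rw [norm_mul, Real.norm_of_nonneg h0]
    have h1 := norm_inner_le_norm (𝕜 := ℝ) w u
    have h2 : ‖w‖ ≤ 1 + ‖w‖ ^ 2 := by nlinarith [sq_nonneg (‖w‖ - 1)]
    calc ‖(inner ℝ w u : ℝ)‖ * gauss b w ≤ (‖w‖ * ‖u‖) * gauss b w := by gcongr
      _ ≤ ((1 + ‖w‖ ^ 2) * ‖u‖) * gauss b w := by gcongr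
      _ = ‖u‖ * (gauss b w + ‖w‖ ^ 2 * gauss b w) := by ring

lemma integral_inner_mul_gauss (b : ℝ) (u : E3) : ∫ w, inner ℝ w u * gauss b w = 0 := by
  have h := integral_neg_eq_self (fun w : E3 => inner ℝ w u * gauss b w) volume
  simp only [inner_neg_left, gauss_neg, neg_mul, integral_neg] at h
  linarith

lemma hasFDerivAt_gauss (b : ℝ) (w : E3) :
    HasFDerivAt (gauss b) ((-2 * b * gauss b w) • innerSL ℝ w) w := by
  have h1 : HasFDerivAt (fun w : E3 => ‖w‖ ^ 2) (2 • innerSL ℝ w) w :=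
    (hasStrictFDerivAt_norm_sq w).hasFDerivAt
  refine ((h1.const_mul (-b)).exp).congr_fderiv ?_
  ext1 h
  simp [gauss]
  ring

/-- Integration by parts: the derivative of the Gaussian along `v` is `-2b ⟨w, v⟩` times the
Gaussian, and it is paired with the linear function `⟨w, u⟩`. -/
lemma integral_inner_mul_inner_mul_gauss {b : ℝ} (hb : 0 < b) (u v : E3) :
    ∫ w, inner ℝ w u * inner ℝ w v * gauss b w = inner ℝ u v / (2 * b) * ∫ w, gauss b w := by
  have hL : ∀ w : E3, HasFDerivAt (fun w : E3 => (inner ℝ w u : ℝ)) (innerSL ℝ u) w := fun w =>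
    (innerSL ℝ u).hasFDerivAt.congr_of_eventuallyEq
      (Eventually.of_forall fun w => by simp [real_inner_comm])
  have h1 : ∀ w : E3, fderiv ℝ (gauss b) w v = -2 * b * gauss b w * inner ℝ w v := fun w => by
    rw [(hasFDerivAt_gauss b w).fderiv]; simp
  have h2 : ∀ w : E3, fderiv ℝ (fun w : E3 => (inner ℝ w u : ℝ)) w v = inner ℝ u v := fun w => by
    rw [(hL w).fderiv]; simp
  have h := integral_mul_fderiv_eq_neg_fderiv_mul_of_integrable (μ := (volume : Measure E3))
    (f := fun w : E3 => (inner ℝ w u : ℝ)) (g := gauss b) (v := v) ?_ ?_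
    (integrable_inner_mul_gauss hb u) (fun w _ => (hL w).differentiableAt)
    (fun w _ => (hasFDerivAt_gauss b w).differentiableAt)
  · simp only [h1, h2] at h
    rw [integral_const_mul] at h
    have h3 : ∫ w, inner ℝ w u * (-2 * b * gauss b w * inner ℝ w v) =
        (-2 * b) * ∫ w, inner ℝ w u * inner ℝ w v * gauss b w := by
      rw [← integral_const_mul]; congr 1; ext w; ring
    rw [h3] at h
    field_simp
    linarith
  · simp only [h2]
    exact (integrable_gauss hb).const_mul _
  · simp only [h1]
    refine ((integrable_inner_mul_inner_mul_gauss hb u v).const_mul (-2 * b)).congr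
      (Eventually.of_forall fun w => ?_)
    simp only
    ring

lemma integral_norm_sq_mul_gauss {b : ℝ} (hb : 0 < b) :
    ∫ w, ‖w‖ ^ 2 * gauss b w = 3 / (2 * b) * ∫ w, gauss b w := by
  have h : ∀ w : E3, ‖w‖ ^ 2 * gauss b w = ∑ i : Fin 3,
      inner ℝ w (EuclideanSpace.single i 1) * inner ℝ w (EuclideanSpace.single i 1) *
        gauss b w := fun w => by
    rw [EuclideanSpace.norm_sq_eq, Finset.sum_mul]
    simp [EuclideanSpace.inner_single_right, sq]
  simp_rw [h]
  rw [integral_finsetSum _ fun i _ => integrable_inner_mul_inner_mul_gauss hb _ _]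
  simp_rw [integral_inner_mul_inner_mul_gauss hb]
  simp
  ring

/-- The Gaussian-weighted pairing of two magnetic dipoles at `p` and `q`. -/
noncomputable def curlPairing (a : ℝ) (p q u v : E3) : ℝ :=
  gauss (2 * a) p * gauss (2 * a) q * (inner ℝ p q * inner ℝ u v - inner ℝ p v * inner ℝ q u)

/-- A smooth positive definite kernel; the Darwin kernel is a superposition of these. -/
noncomputable def heatKernel (a : ℝ) (d u v : E3) : ℝ :=
  gauss a d * ((1 - a * ‖d‖ ^ 2) * inner ℝ u v + a * (inner ℝ d u * inner ℝ d v))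

lemma integral_curlPairing {a : ℝ} (ha : 0 < a) (x y u v : E3) :
    ∫ z, curlPairing a (x - z) (y - z) u v =
      (∫ w, gauss (4 * a) w) / (4 * a) * heatKernel a (x - y) u v := by
  have hb : 0 < 4 * a := by positivity
  -- Centering at the midpoint makes the product of the two Gaussians split into `gauss a d * gauss
  -- (4 * a) w` by the parallelogram identity. The terms linear in `w` then integrate to zero, and
  -- the second moments give `heatKernel`.
  set m : E3 := (1 / 2 : ℝ) • (x + y) with hm
  set d : E3 := x - y with hd
  have hx : ∀ w : E3, x - (w + m) = (1 / 2 : ℝ) • d - w := fun w => by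
    rw [hm, hd]; module
  have hy : ∀ w : E3, y - (w + m) = -((1 / 2 : ℝ) • d) - w := fun w => by
    rw [hm, hd]; module
  rw [← integral_add_right_eq_self _ m]
  simp only [hx, hy]
  have key : ∀ w : E3, curlPairing a ((1 / 2 : ℝ) • d - w) (-((1 / 2 : ℝ) • d) - w) u v =
      gauss a d * (inner ℝ u v * (‖w‖ ^ 2 * gauss (4 * a) w) +
        (-(‖d‖ ^ 2 / 4) * inner ℝ u v + inner ℝ d u * inner ℝ d v / 4) * gauss (4 * a) w +
        (inner ℝ d v / 2) * (inner ℝ w u * gauss (4 * a) w) +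
        (-(inner ℝ d u / 2)) * (inner ℝ w v * gauss (4 * a) w) +
        (-1) * (inner ℝ w u * inner ℝ w v * gauss (4 * a) w)) := fun w => by
    have hg : gauss (2 * a) ((1 / 2 : ℝ) • d - w) * gauss (2 * a) (-((1 / 2 : ℝ) • d) - w) =
        gauss a d * gauss (4 * a) w := by
      unfold gauss
      rw [← Real.exp_add, ← Real.exp_add]
      congr 1
      have e : -((1 / 2 : ℝ) • d) - w = -((1 / 2 : ℝ) • d + w) := by abel
      rw [e, norm_neg, norm_sub_sq_real, norm_add_sq_real, norm_smul]
      norm_num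
      ring
    unfold curlPairing
    rw [hg]
    simp only [inner_sub_left, inner_sub_right, inner_neg_left, inner_neg_right,
      real_inner_smul_left, real_inner_smul_right, real_inner_self_eq_norm_sq,
      real_inner_comm d w, norm_smul]
    norm_num
    ring
  simp only [key]
  have i1 := (integrable_norm_sq_mul_gauss hb).const_mul (inner ℝ u v : ℝ)
  have i2 := (integrable_gauss hb).const_mul
    (-(‖d‖ ^ 2 / 4) * inner ℝ u v + inner ℝ d u * inner ℝ d v / 4 : ℝ)
  have i3 := (integrable_inner_mul_gauss hb u).const_mul (inner ℝ d v / 2 : ℝ)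
  have i4 := (integrable_inner_mul_gauss hb v).const_mul (-(inner ℝ d u / 2) : ℝ)
  have i5 := (integrable_inner_mul_inner_mul_gauss hb u v).const_mul (-1 : ℝ)
  have s2 := i1.add i2
  have s3 := s2.add i3
  have s4 := s3.add i4
  simp only [Pi.add_def] at s2 s3 s4
  rw [integral_const_mul, integral_add s4 i5, integral_add s3 i4, integral_add s2 i3,
    integral_add i1 i2]
  simp only [integral_const_mul]
  rw [integral_norm_sq_mul_gauss hb, integral_inner_mul_gauss, integral_inner_mul_gauss,
    integral_inner_mul_inner_mul_gauss hb, heatKernel]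
  field_simp
  ring

/-- The components of the Gaussian magnetic field at `z` of a dipole `u` at `x`. -/
noncomputable def curlField (a : ℝ) (i k : Fin 3) (p u : E3) : ℝ :=
  gauss (2 * a) p * (p i * u k - p k * u i)

/-- This is the Binet–Cauchy identity for `(p × u) · (q × v)`; the factor two arises since each
component of the cross product occurs for both orders of `i` and `k`. -/
lemma sum_curlField_mul (a : ℝ) (p q u v : E3) :
    ∑ i, ∑ k, curlField a i k p u * curlField a i k q v = 2 * curlPairing a p q u v := by
  simp only [curlField, curlPairing, Fin.sum_univ_three, PiLp.inner_apply, RCLike.inner_apply,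
    conj_trivial]
  ring

lemma abs_curlField_le {a : ℝ} (ha : 0 < a) (i k : Fin 3) (p u : E3) :
    |curlField a i k p u| ≤ 2 * (1 + 2 / a) * ‖u‖ * gauss (a / 2) p := by
  have h0 := (gauss_pos (2 * a) p).le
  have hp : ∀ i, |p i| ≤ ‖p‖ := fun i => PiLp.norm_apply_le p i
  have hu : ∀ i, |u i| ≤ ‖u‖ := fun i => PiLp.norm_apply_le u i
  have h1 : |p i * u k - p k * u i| ≤ 2 * (‖p‖ * ‖u‖) := by
    refine (abs_sub _ _).trans ?_
    rw [abs_mul, abs_mul, two_mul]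
    gcongr <;> first | exact hp _ | exact hu _
  have h2 : ‖p‖ ≤ 1 + ‖p‖ ^ 2 := by nlinarith [sq_nonneg (‖p‖ - 1)]
  have h3 : gauss (2 * a) p ≤ gauss a p := by
    unfold gauss; gcongr; linarith
  have h4 : gauss a p ≤ gauss (a / 2) p := by
    unfold gauss; gcongr; linarith
  have h5 := norm_sq_mul_gauss_le ha p
  have h6 : ‖p‖ * gauss (2 * a) p ≤ (1 + 2 / a) * gauss (a / 2) p := by
    calc ‖p‖ * gauss (2 * a) p ≤ (1 + ‖p‖ ^ 2) * gauss a p := by gcongr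
      _ = gauss a p + ‖p‖ ^ 2 * gauss a p := by ring
      _ ≤ gauss (a / 2) p + 2 / a * gauss (a / 2) p := by gcongr
      _ = _ := by ring
  rw [curlField, abs_mul, abs_of_nonneg h0]
  calc gauss (2 * a) p * |p i * u k - p k * u i| ≤ gauss (2 * a) p * (2 * (‖p‖ * ‖u‖)) := by
        gcongr
    _ = 2 * ‖u‖ * (‖p‖ * gauss (2 * a) p) := by ring
    _ ≤ 2 * ‖u‖ * ((1 + 2 / a) * gauss (a / 2) p) := by gcongr
    _ = _ := by ring

lemma continuous_curlField (a : ℝ) (i k : Fin 3) :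
    Continuous fun q : E3 × E3 => curlField a i k q.1 q.2 := by
  have := continuous_gauss (2 * a)
  unfold curlField
  fun_prop

end Gaussian

/-! ### Positivity of the Gaussian kernels -/

section Positivity

/-- After Fubini the integrand in `z` is the square of `∫ F x z dμ(x)`. -/
lemma integral_integral_mul_self_nonneg {α β : Type*} [MeasurableSpace α] [MeasurableSpace β]
    {μ : Measure α} {ν : Measure β} [SFinite μ] [SFinite ν] {F : α → β → ℝ}
    (h : Integrable (fun q : (α × α) × β => F q.1.1 q.2 * F q.1.2 q.2) ((μ.prod μ).prod ν)) :
    0 ≤ ∫ q, ∫ z, F q.1 z * F q.2 z ∂ν ∂(μ.prod μ) := by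
  rw [integral_integral_swap (f := fun q : α × α => fun z => F q.1 z * F q.2 z) h]
  refine integral_nonneg fun z => ?_
  rw [integral_prod_mul (fun x => F x z) (fun x => F x z)]
  exact mul_self_nonneg _

variable {μ : Measure E3} {j : E3 → E3}

lemma integrable_curlField_mul (hj : Integrable j μ) {a : ℝ} (ha : 0 < a) (i k : Fin 3) :
    Integrable (fun q : (E3 × E3) × E3 => curlField a i k (q.1.1 - q.2) (j q.1.1) *
      curlField a i k (q.1.2 - q.2) (j q.1.2)) ((μ.prod μ).prod volume) := by
  set c : ℝ := 2 * (1 + 2 / a) with hc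
  have hc0 : 0 ≤ c := by positivity
  have ha2 : 0 < a / 2 := by positivity
  have hm1 : AEStronglyMeasurable (fun q : (E3 × E3) × E3 => j q.1.1) ((μ.prod μ).prod volume) :=
    (hj.aestronglyMeasurable.comp_fst).comp_fst
  have hm2 : AEStronglyMeasurable (fun q : (E3 × E3) × E3 => j q.1.2) ((μ.prod μ).prod volume) :=
    (hj.aestronglyMeasurable.comp_snd).comp_fst
  -- One of the two Gaussian factors suffices for integrability in `z`; the other is bounded by one
  -- below.
  have hdom : Integrable (fun q : (E3 × E3) × E3 =>
      (‖j q.1.1‖ * ‖j q.1.2‖) * gauss (a / 2) (q.1.1 - q.2)) ((μ.prod μ).prod volume) := by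
    have hcg := continuous_gauss (a / 2)
    have hmeas : AEStronglyMeasurable (fun q : (E3 × E3) × E3 =>
        (‖j q.1.1‖ * ‖j q.1.2‖) * gauss (a / 2) (q.1.1 - q.2)) ((μ.prod μ).prod volume) :=
      (hm1.norm.mul hm2.norm).mul (Continuous.aestronglyMeasurable (by fun_prop))
    refine (integrable_prod_iff hmeas).2 ⟨?_, ?_⟩
    · refine Eventually.of_forall fun q => ?_
      exact ((integrable_gauss ha2).comp_sub_left q.1).const_mul (‖j q.1‖ * ‖j q.2‖)
    · have : ∀ q : E3 × E3,
          ∫ z, ‖(‖j q.1‖ * ‖j q.2‖) * gauss (a / 2) (q.1 - z)‖ =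
            ‖j q.1‖ * ‖j q.2‖ * ∫ w, gauss (a / 2) w := fun q => by
        simp only [norm_mul, norm_norm, Real.norm_of_nonneg (gauss_pos _ _).le]
        rw [integral_const_mul, integral_sub_left_eq_self (gauss (a / 2)) volume q.1]
      simp only [this]
      exact (hj.norm.mul_prod hj.norm).mul_const _
  refine Integrable.mono' (hdom.const_mul (c * c)) ?_ ?_
  · have h1 : AEStronglyMeasurable (fun q : (E3 × E3) × E3 => q.1.1 - q.2)
        ((μ.prod μ).prod volume) := Continuous.aestronglyMeasurable (by fun_prop)
    have h2 : AEStronglyMeasurable (fun q : (E3 × E3) × E3 => q.1.2 - q.2)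
        ((μ.prod μ).prod volume) := Continuous.aestronglyMeasurable (by fun_prop)
    have hc := Continuous.comp_aestronglyMeasurable
      (g := fun q : E3 × E3 => curlField a i k q.1 q.2) (continuous_curlField a i k)
      (h1.prodMk hm1)
    have hc' := Continuous.comp_aestronglyMeasurable
      (g := fun q : E3 × E3 => curlField a i k q.1 q.2) (continuous_curlField a i k)
      (h2.prodMk hm2)
    exact hc.mul hc'
  · refine Eventually.of_forall fun q => ?_
    rw [norm_mul, Real.norm_eq_abs, Real.norm_eq_abs]
    have h1 := abs_curlField_le ha i k (q.1.1 - q.2) (j q.1.1)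
    have h2 := abs_curlField_le ha i k (q.1.2 - q.2) (j q.1.2)
    have h3 := gauss_le_one ha2.le (q.1.2 - q.2)
    have h4 := gauss_pos (a / 2) (q.1.1 - q.2)
    have h5 := gauss_pos (a / 2) (q.1.2 - q.2)
    calc _ ≤ (c * ‖j q.1.1‖ * gauss (a / 2) (q.1.1 - q.2)) *
          (c * ‖j q.1.2‖ * gauss (a / 2) (q.1.2 - q.2)) := by gcongr
      _ ≤ (c * ‖j q.1.1‖ * gauss (a / 2) (q.1.1 - q.2)) * (c * ‖j q.1.2‖ * 1) := by gcongr
      _ = _ := by ring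

/-- Up to a positive constant this is the energy of the total Gaussian magnetic field generated by
`j`, a sum of squares over the components `i, k`. -/
lemma integral_heatKernel_nonneg [SFinite μ] (hj : Integrable j μ) {a : ℝ} (ha : 0 < a) :
    0 ≤ ∫ q, heatKernel a (q.1 - q.2) (j q.1) (j q.2) ∂(μ.prod μ) := by
  have hI := fun i k => integrable_curlField_mul hj ha i k
  have h1 : ∀ i k, 0 ≤ ∫ q, ∫ z, curlField a i k (q.1 - z) (j q.1) *
      curlField a i k (q.2 - z) (j q.2) ∂volume ∂(μ.prod μ) := fun i k =>
    integral_integral_mul_self_nonneg (F := fun x z => curlField a i k (x - z) (j x)) (hI i k)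
  have hae : ∀ᵐ q ∂(μ.prod μ), ∀ i k, Integrable (fun z => curlField a i k (q.1 - z) (j q.1) *
      curlField a i k (q.2 - z) (j q.2)) := by
    rw [ae_all_iff]; intro i; rw [ae_all_iff]; intro k
    exact (hI i k).prod_right_ae
  have h2 : ∫ q, 2 * ((∫ w, gauss (4 * a) w) / (4 * a) *
      heatKernel a (q.1 - q.2) (j q.1) (j q.2)) ∂(μ.prod μ) =
      ∑ i, ∑ k, ∫ q, ∫ z, curlField a i k (q.1 - z) (j q.1) *
        curlField a i k (q.2 - z) (j q.2) ∂volume ∂(μ.prod μ) := by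
    have hs : ∀ i k, Integrable (fun q : E3 × E3 => ∫ z, curlField a i k (q.1 - z) (j q.1) *
        curlField a i k (q.2 - z) (j q.2)) (μ.prod μ) := fun i k => (hI i k).integral_prod_left
    simp_rw [← integral_finsetSum _ fun k _ => hs _ k]
    rw [← integral_finsetSum _ fun i _ => integrable_finsetSum _ fun k _ => hs i k]
    refine integral_congr_ae ?_
    filter_upwards [hae] with q hq
    simp_rw [← integral_finsetSum _ fun k _ => hq _ k]
    rw [← integral_finsetSum _ fun i _ => integrable_finsetSum _ fun k _ => hq i k]
    simp_rw [sum_curlField_mul]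
    rw [integral_const_mul, integral_curlPairing ha]
  rw [integral_const_mul, integral_const_mul] at h2
  have hc : 0 < 2 * ((∫ w, gauss (4 * a) w) / (4 * a)) := by
    have := integral_gauss_pos (b := 4 * a) (by positivity)
    positivity
  have h3 : 0 ≤ ∑ i, ∑ k, ∫ q, ∫ z, curlField a i k (q.1 - z) (j q.1) *
        curlField a i k (q.2 - z) (j q.2) ∂volume ∂(μ.prod μ) :=
    Finset.sum_nonneg fun i _ => Finset.sum_nonneg fun k _ => h1 i k
  rw [← h2, ← mul_assoc] at h3
  exact nonneg_of_mul_nonneg_right h3 hc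

end Positivity

/-! ### The Darwin kernel as a superposition of Gaussian kernels over all scales -/

section Superposition

lemma gauss_eq (a : ℝ) (d : E3) : gauss a d = Real.exp (-(‖d‖ ^ 2 * a)) := by
  unfold gauss; ring_nf

lemma integrableOn_rpow_mul_gauss {d : E3} (hd : d ≠ 0) {s : ℝ} (hs : 0 < s) :
    IntegrableOn (fun a : ℝ => a ^ (s - 1) * gauss a d) (Ioi 0) := by
  have h := integrableOn_rpow_mul_exp_neg_mul_rpow (p := 1) (s := s - 1) (b := ‖d‖ ^ 2)
    (by linarith) one_pos (by positivity)
  refine h.congr_fun (fun a _ => ?_) measurableSet_Ioi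
  simp [gauss_eq]

lemma integral_rpow_half_mul_gauss {d : E3} (hd : d ≠ 0) :
    ∫ a in Ioi (0 : ℝ), a ^ ((1 / 2 : ℝ) - 1) * gauss a d = √Real.pi * ‖d‖⁻¹ := by
  have hs : 0 < ‖d‖ := norm_pos_iff.2 hd
  simp_rw [gauss_eq]
  rw [Real.integral_rpow_mul_exp_neg_mul_Ioi (by norm_num) (by positivity), Real.Gamma_one_half_eq,
    ← Real.sqrt_eq_rpow, Real.sqrt_div zero_le_one, Real.sqrt_one, Real.sqrt_sq hs.le]
  ring

lemma integral_rpow_three_halves_mul_gauss {d : E3} (hd : d ≠ 0) :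
    ∫ a in Ioi (0 : ℝ), a ^ ((3 / 2 : ℝ) - 1) * gauss a d = √Real.pi / 2 * ‖d‖⁻¹ ^ 3 := by
  have hs : 0 < ‖d‖ := norm_pos_iff.2 hd
  have hG : Real.Gamma (3 / 2) = √Real.pi / 2 := by
    have := Real.Gamma_add_one (s := 1 / 2) (by norm_num)
    rw [Real.Gamma_one_half_eq] at this
    norm_num at this
    rw [this]; ring
  have hp : (1 / ‖d‖ ^ 2) ^ (3 / 2 : ℝ) = ‖d‖⁻¹ ^ 3 := by
    rw [one_div, ← inv_pow, ← Real.rpow_natCast, ← Real.rpow_mul (by positivity),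
      ← Real.rpow_natCast]
    norm_num
  simp_rw [gauss_eq]
  rw [Real.integral_rpow_mul_exp_neg_mul_Ioi (by norm_num) (by positivity), hG, hp]
  ring

lemma rpow_mul_heatKernel {a : ℝ} (ha : 0 < a) (d u v : E3) :
    a ^ ((1 / 2 : ℝ) - 1) * heatKernel a d u v =
      inner ℝ u v * (a ^ ((1 / 2 : ℝ) - 1) * gauss a d) +
        (inner ℝ d u * inner ℝ d v - ‖d‖ ^ 2 * inner ℝ u v) *
          (a ^ ((3 / 2 : ℝ) - 1) * gauss a d) := by
  have h : a ^ ((3 / 2 : ℝ) - 1) = a ^ ((1 / 2 : ℝ) - 1) * a := by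
    rw [← Real.rpow_add_one ha.ne']; norm_num
  rw [h, heatKernel]; ring

/-- The Gamma integrals give `√π ‖d‖⁻¹` and `√π / 2 ‖d‖⁻³`. The term `-‖d‖² ⟨u, v⟩` removes half of
the first, and what remains is the Darwin combination with equal coefficients. -/
lemma integral_rpow_mul_heatKernel {d : E3} (hd : d ≠ 0) (u v : E3) :
    ∫ a in Ioi (0 : ℝ), a ^ ((1 / 2 : ℝ) - 1) * heatKernel a d u v =
      √Real.pi / 2 * inner ℝ u (dipole ‖d‖⁻¹ (‖d‖⁻¹ ^ 3) d v) := by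
  have hs : ‖d‖ ≠ 0 := norm_ne_zero_iff.2 hd
  rw [setIntegral_congr_fun measurableSet_Ioi fun a ha => rpow_mul_heatKernel ha d u v,
    integral_add ((integrableOn_rpow_mul_gauss hd (by norm_num)).const_mul _)
      ((integrableOn_rpow_mul_gauss hd (by norm_num)).const_mul _),
    integral_const_mul, integral_const_mul, integral_rpow_half_mul_gauss hd,
    integral_rpow_three_halves_mul_gauss hd, dipole, inner_add_right, real_inner_smul_right,
    real_inner_smul_right, real_inner_comm d u]
  field_simp
  ring

/-- A dominating function for the superposition of heat kernels. -/
noncomputable def heatBound (a : ℝ) (d : E3) : ℝ :=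
  a ^ ((1 / 2 : ℝ) - 1) * gauss a d + 2 * ‖d‖ ^ 2 * (a ^ ((3 / 2 : ℝ) - 1) * gauss a d)

lemma heatBound_nonneg {a : ℝ} (ha : 0 < a) (d : E3) : 0 ≤ heatBound a d := by
  have := (gauss_pos a d).le
  unfold heatBound; positivity

lemma abs_rpow_mul_heatKernel_le {a : ℝ} (ha : 0 < a) (d u v : E3) :
    |a ^ ((1 / 2 : ℝ) - 1) * heatKernel a d u v| ≤ ‖u‖ * ‖v‖ * heatBound a d := by
  have hg := (gauss_pos a d).le
  have h1 := abs_real_inner_le_norm u v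
  have h2 := abs_real_inner_le_norm d u
  have h3 := abs_real_inner_le_norm d v
  have e1 : 0 ≤ a ^ ((1 / 2 : ℝ) - 1) * gauss a d := by positivity
  have e2 : 0 ≤ a ^ ((3 / 2 : ℝ) - 1) * gauss a d := by positivity
  rw [rpow_mul_heatKernel ha]
  refine (abs_add_le _ _).trans ?_
  rw [abs_mul, abs_mul _ (a ^ ((3 / 2 : ℝ) - 1) * gauss a d), abs_of_nonneg e1,
    abs_of_nonneg e2]
  have h4 : |inner ℝ d u * inner ℝ d v - ‖d‖ ^ 2 * inner ℝ u v| ≤ ‖u‖ * ‖v‖ * (2 * ‖d‖ ^ 2) := by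
    refine (abs_sub _ _).trans ?_
    rw [abs_mul, abs_mul, abs_of_nonneg (a := ‖d‖ ^ 2) (by positivity)]
    calc _ ≤ (‖d‖ * ‖u‖) * (‖d‖ * ‖v‖) + ‖d‖ ^ 2 * (‖u‖ * ‖v‖) := by gcongr
      _ = _ := by ring
  calc _ ≤ (‖u‖ * ‖v‖) * (a ^ ((1 / 2 : ℝ) - 1) * gauss a d) +
        ‖u‖ * ‖v‖ * (2 * ‖d‖ ^ 2) * (a ^ ((3 / 2 : ℝ) - 1) * gauss a d) := by gcongr
    _ = _ := by unfold heatBound; ring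

lemma integrableOn_heatBound {d : E3} (hd : d ≠ 0) :
    IntegrableOn (fun a => heatBound a d) (Ioi 0) :=
  (integrableOn_rpow_mul_gauss hd (by norm_num)).add
    ((integrableOn_rpow_mul_gauss hd (by norm_num)).const_mul _)

lemma integral_heatBound {d : E3} (hd : d ≠ 0) :
    ∫ a in Ioi (0 : ℝ), heatBound a d = 2 * √Real.pi * ‖d‖⁻¹ := by
  have hs : ‖d‖ ≠ 0 := norm_ne_zero_iff.2 hd
  unfold heatBound
  rw [integral_add (integrableOn_rpow_mul_gauss hd (by norm_num))
      ((integrableOn_rpow_mul_gauss hd (by norm_num)).const_mul _),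
    integral_const_mul, integral_rpow_half_mul_gauss hd,
    integral_rpow_three_halves_mul_gauss hd]
  field_simp
  norm_num

lemma measurable_heatBound : Measurable fun q : E3 × ℝ => heatBound q.2 q.1 := by
  unfold heatBound gauss
  fun_prop

lemma measurable_rpow_mul_heatKernel :
    Measurable fun q : (E3 × E3 × E3) × ℝ =>
      q.2 ^ ((1 / 2 : ℝ) - 1) * heatKernel q.2 q.1.1 q.1.2.1 q.1.2.2 := by
  unfold heatKernel gauss
  fun_prop

variable {μ : Measure E3} [SFinite μ] {j : E3 → E3}

lemma ae_prod_sub_ne_zero [NullSingletonClass μ] : ∀ᵐ q ∂(μ.prod μ), q.1 - q.2 ≠ 0 := by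
  have hm : MeasurableSet {q : E3 × E3 | q.1 - q.2 = 0} :=
    (isClosed_eq (by fun_prop) continuous_const).measurableSet
  rw [ae_iff]
  simp only [ne_eq, not_not]
  rw [Measure.measure_prod_null hm]
  refine Eventually.of_forall fun x => ?_
  have : Prod.mk x ⁻¹' {q : E3 × E3 | q.1 - q.2 = 0} = {x} := by
    ext y; simp [sub_eq_zero, eq_comm]
  simp [this]

/-- The quadratic form is an integral over `a` of nonnegative forms. Fubini applies because
`heatBound` integrates in `a` to a multiple of `‖d‖⁻¹`, so that `hI` controls the majorant; the
diagonal is null since `μ` has no atoms. -/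
lemma integral_inner_dipole_nonneg [NullSingletonClass μ] (hj : Integrable j μ)
    (hI : Integrable (fun q : E3 × E3 => ‖j q.1‖ * ‖j q.2‖ * ‖q.1 - q.2‖⁻¹) (μ.prod μ)) :
    0 ≤ ∫ q, inner ℝ (j q.1) (dipole ‖q.1 - q.2‖⁻¹ (‖q.1 - q.2‖⁻¹ ^ 3) (q.1 - q.2) (j q.2))
      ∂(μ.prod μ) := by
  set ν : Measure ℝ := volume.restrict (Ioi 0) with hν
  have hne := ae_prod_sub_ne_zero (μ := μ)
  have hm1 : AEStronglyMeasurable (fun q : (E3 × E3) × ℝ => j q.1.1) ((μ.prod μ).prod ν) :=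
    (hj.aestronglyMeasurable.comp_fst).comp_fst
  have hm2 : AEStronglyMeasurable (fun q : (E3 × E3) × ℝ => j q.1.2) ((μ.prod μ).prod ν) :=
    (hj.aestronglyMeasurable.comp_snd).comp_fst
  have hpos : ∀ᵐ q ∂((μ.prod μ).prod ν), 0 < q.2 :=
    Measure.quasiMeasurePreserving_snd.ae (ae_restrict_mem measurableSet_Ioi)
  have hdom : Integrable (fun q : (E3 × E3) × ℝ =>
      ‖j q.1.1‖ * ‖j q.1.2‖ * heatBound q.2 (q.1.1 - q.1.2)) ((μ.prod μ).prod ν) := by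
    have hmeas : AEStronglyMeasurable (fun q : (E3 × E3) × ℝ =>
        ‖j q.1.1‖ * ‖j q.1.2‖ * heatBound q.2 (q.1.1 - q.1.2)) ((μ.prod μ).prod ν) := by
      refine (hm1.norm.mul hm2.norm).mul ?_
      exact (measurable_heatBound.comp
        (g := fun q : E3 × ℝ => heatBound q.2 q.1)
        (f := fun q : (E3 × E3) × ℝ => (q.1.1 - q.1.2, q.2)) (by fun_prop)).aestronglyMeasurable
    refine (integrable_prod_iff hmeas).2 ⟨?_, ?_⟩
    · filter_upwards [hne] with q hq
      exact (integrableOn_heatBound hq).const_mul (‖j q.1‖ * ‖j q.2‖)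
    · refine (hI.const_mul (2 * √Real.pi)).congr ?_
      filter_upwards [hne] with q hq
      have : ∫ a, ‖‖j q.1‖ * ‖j q.2‖ * heatBound a (q.1 - q.2)‖ ∂ν =
          ∫ a, ‖j q.1‖ * ‖j q.2‖ * heatBound a (q.1 - q.2) ∂ν := by
        refine setIntegral_congr_fun measurableSet_Ioi fun a ha => ?_
        exact Real.norm_of_nonneg
          (mul_nonneg (by positivity) (heatBound_nonneg ha _))
      simp only [this]
      rw [integral_const_mul, integral_heatBound hq]
      ring
  have hint : Integrable (fun q : (E3 × E3) × ℝ => q.2 ^ ((1 / 2 : ℝ) - 1) *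
      heatKernel q.2 (q.1.1 - q.1.2) (j q.1.1) (j q.1.2)) ((μ.prod μ).prod ν) := by
    refine Integrable.mono' hdom ?_ ?_
    · have h1 : AEMeasurable (fun q : (E3 × E3) × ℝ => ((q.1.1 - q.1.2, j q.1.1, j q.1.2), q.2))
          ((μ.prod μ).prod ν) := by
        refine AEMeasurable.prodMk (AEMeasurable.prodMk (by fun_prop) ?_) (by fun_prop)
        exact hm1.aemeasurable.prodMk hm2.aemeasurable
      exact (measurable_rpow_mul_heatKernel.comp_aemeasurable h1).aestronglyMeasurable
    · filter_upwards [hpos] with q hq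
      exact abs_rpow_mul_heatKernel_le hq _ _ _
  have hswap := integral_integral_swap (f := fun (q : E3 × E3) (a : ℝ) =>
    a ^ ((1 / 2 : ℝ) - 1) * heatKernel a (q.1 - q.2) (j q.1) (j q.2)) hint
  have h1 : 0 ≤ ∫ a, ∫ q, a ^ ((1 / 2 : ℝ) - 1) *
      heatKernel a (q.1 - q.2) (j q.1) (j q.2) ∂(μ.prod μ) ∂ν := by
    refine setIntegral_nonneg measurableSet_Ioi fun a ha => ?_
    rw [integral_const_mul]
    exact mul_nonneg (Real.rpow_nonneg (le_of_lt ha) _) (integral_heatKernel_nonneg hj ha)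
  rw [← hswap] at h1
  have h2 : ∫ q, ∫ a, a ^ ((1 / 2 : ℝ) - 1) *
      heatKernel a (q.1 - q.2) (j q.1) (j q.2) ∂ν ∂(μ.prod μ) =
      ∫ q, √Real.pi / 2 * inner ℝ (j q.1)
        (dipole ‖q.1 - q.2‖⁻¹ (‖q.1 - q.2‖⁻¹ ^ 3) (q.1 - q.2) (j q.2)) ∂(μ.prod μ) := by
    refine integral_congr_ae ?_
    filter_upwards [hne] with q hq
    exact integral_rpow_mul_heatKernel hq _ _
  rw [h2, integral_const_mul] at h1
  exact nonneg_of_mul_nonneg_right h1 (by positivity)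

end Superposition

/-! ### Fixed points of positive operators composed with antitone cocoercive maps -/

section FixedPoint

variable {H : Type*} [NormedAddCommGroup H] [InnerProductSpace ℝ H]

/-- One relaxation step contracts the energy associated with a positive operator. -/
lemma relaxation_energy_le {T : H →L[ℝ] H} (hsym : ∀ x y, inner ℝ (T x) y = inner ℝ x (T y))
    {c L ε : ℝ} (hc : ‖T‖ ≤ c) (hL : 0 < L) (hε : 0 < ε) (hε2 : ε ≤ 1 / 2)
    (hεc : ε * (c * L) ≤ 1 / 2) (hT : ∀ x, 0 ≤ inner ℝ (T x) x) {e d : H}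
    (hd : ‖d‖ ^ 2 ≤ L * -inner ℝ d (T e)) :
    let e' := (1 - ε) • e + ε • d
    inner ℝ (T e') e' + 1 / (2 * L) * ‖e'‖ ^ 2 ≤
      (1 - ε) * (inner ℝ (T e) e + 1 / (2 * L) * ‖e‖ ^ 2) := by
  intro e'
  set s : ℝ := -inner ℝ d (T e) with hs
  have hs0 : 0 ≤ s := by
    by_contra h
    nlinarith [sq_nonneg ‖d‖]
  have h1 : inner ℝ (T e') e' = (1 - ε) ^ 2 * inner ℝ (T e) e - 2 * ε * (1 - ε) * s +
      ε ^ 2 * inner ℝ (T d) d := by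
    simp only [e', map_add, map_smul, inner_add_left, inner_add_right, real_inner_smul_left,
      real_inner_smul_right, hs, hsym d e, real_inner_comm d (T e)]
    ring
  have h2 : inner ℝ (T d) d ≤ c * (L * s) := by
    calc inner ℝ (T d) d ≤ ‖T d‖ * ‖d‖ := real_inner_le_norm _ _
      _ ≤ (‖T‖ * ‖d‖) * ‖d‖ := by gcongr; exact T.le_opNorm d
      _ = ‖T‖ * ‖d‖ ^ 2 := by ring
      _ ≤ c * (L * s) := by
        have : 0 ≤ c := (norm_nonneg T).trans hc
        gcongr
  have h3 : ‖e'‖ ^ 2 ≤ (1 - ε) * ‖e‖ ^ 2 + ε * ‖d‖ ^ 2 := by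
    have h4 : ‖e'‖ ^ 2 = (1 - ε) ^ 2 * ‖e‖ ^ 2 + 2 * (ε * (1 - ε)) * inner ℝ e d +
        ε ^ 2 * ‖d‖ ^ 2 := by
      simp only [e', norm_add_sq_real, real_inner_smul_left, real_inner_smul_right, norm_smul,
        mul_pow, Real.norm_eq_abs, sq_abs]
      ring
    have h5 : 2 * inner ℝ e d ≤ ‖e‖ ^ 2 + ‖d‖ ^ 2 := by
      have := norm_sub_sq_real e d
      nlinarith [sq_nonneg ‖e - d‖]
    have h6 : 0 ≤ ε * (1 - ε) := mul_nonneg hε.le (by linarith)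
    rw [h4]
    nlinarith [mul_le_mul_of_nonneg_left h5 h6]
  -- The weight `1 / (2 * L)` is chosen so that `‖d‖² ≤ L * s` costs only `ε / 2 * s` here. With the
  -- equal cost in `h8`, the total is `ε * s`, which the negative cross term of `h1` absorbs by
  -- `h10`.
  have h7 : 1 / (2 * L) * ‖e'‖ ^ 2 ≤ (1 - ε) * (1 / (2 * L) * ‖e‖ ^ 2) + ε / 2 * s := by
    calc 1 / (2 * L) * ‖e'‖ ^ 2 ≤ 1 / (2 * L) * ((1 - ε) * ‖e‖ ^ 2 + ε * (L * s)) := by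
          gcongr
          exact h3.trans (by gcongr)
      _ = _ := by field_simp
  have h8 : ε ^ 2 * inner ℝ (T d) d ≤ ε / 2 * s := by
    calc ε ^ 2 * inner ℝ (T d) d ≤ ε ^ 2 * (c * (L * s)) := by gcongr
      _ = ε * (ε * (c * L)) * s := by ring
      _ ≤ ε * (1 / 2) * s := by gcongr
      _ = _ := by ring
  have h9 : (1 - ε) ^ 2 * inner ℝ (T e) e ≤ (1 - ε) * inner ℝ (T e) e := by
    have := hT e
    have : (1 - ε) ^ 2 ≤ 1 - ε := by nlinarith
    gcongr
  have h10 : ε * s ≤ 2 * ε * (1 - ε) * s := by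
    have : ε ≤ 2 * ε * (1 - ε) := by nlinarith
    gcongr
  rw [h1]
  linarith

/-- A positive symmetric operator composed with an antitone cocoercive map has a fixed point. -/
theorem exists_fixedPoint_of_cocoercive [CompleteSpace H] {T : H →L[ℝ] H}
    (hsym : ∀ x y, inner ℝ (T x) y = inner ℝ x (T y)) (hT : ∀ x, 0 ≤ inner ℝ (T x) x)
    {N : H → H} {L : ℝ} (hL : 0 < L)
    (hN : ∀ a b, ‖N a - N b‖ ^ 2 ≤ L * -inner ℝ (N a - N b) (a - b)) :
    ∃ a, T (N a) = a := by
  set c : ℝ := ‖T‖ with hc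
  have hc0 : 0 ≤ c := norm_nonneg T
  -- This step size satisfies both requirements of `relaxation_energy_le`: `ε ≤ 1 / 2` and `ε * (c *
  -- L) ≤ 1 / 2`.
  set ε : ℝ := 1 / (2 + 2 * (c * L)) with hεdef
  have hcL : 0 ≤ c * L := by positivity
  have hε : 0 < ε := by positivity
  have hε2 : ε ≤ 1 / 2 := by
    rw [hεdef]; gcongr; linarith
  have hεc : ε * (c * L) ≤ 1 / 2 := by
    rw [hεdef, div_mul_eq_mul_div, div_le_div_iff₀ (by positivity) (by norm_num)]
    linarith
  -- The iteration runs on the currents `j`, and the fixed point sought is `T j`.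
  set S : H → H := fun j => (1 - ε) • j + ε • N (T j) with hS
  -- The form of `T` may be degenerate; the multiple of `‖e‖²` makes the energy equivalent to the
  -- squared norm.
  set V : H → ℝ := fun e => inner ℝ (T e) e + 1 / (2 * L) * ‖e‖ ^ 2 with hV
  have hstep : ∀ j k, V (S j - S k) ≤ (1 - ε) * V (j - k) := fun j k => by
    have hd : ‖N (T j) - N (T k)‖ ^ 2 ≤ L * -inner ℝ (N (T j) - N (T k)) (T (j - k)) := by
      rw [map_sub]; exact hN _ _
    have h := relaxation_energy_le hsym le_rfl hL hε hε2 hεc hT hd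
    have e : S j - S k = (1 - ε) • (j - k) + ε • (N (T j) - N (T k)) := by
      simp only [hS]; module
    rw [e]; exact h
  have hiter : ∀ (n : ℕ) j k, V (S^[n] j - S^[n] k) ≤ (1 - ε) ^ n * V (j - k) := by
    intro n
    induction n with
    | zero => intro j k; simp
    | succ n ih =>
      intro j k
      rw [Function.iterate_succ_apply, Function.iterate_succ_apply, pow_succ, mul_assoc]
      exact (ih _ _).trans
        (mul_le_mul_of_nonneg_left (hstep j k) (pow_nonneg (by linarith) n))
  set D : ℝ := 2 * L * (c + 1 / (2 * L)) with hD
  have hD0 : 0 ≤ D := by positivity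
  have hnorm : ∀ (n : ℕ) j k, ‖S^[n] j - S^[n] k‖ ^ 2 ≤ (1 - ε) ^ n * D * ‖j - k‖ ^ 2 := by
    intro n j k
    have h1 : V (j - k) ≤ (c + 1 / (2 * L)) * ‖j - k‖ ^ 2 := by
      have : inner ℝ (T (j - k)) (j - k) ≤ c * ‖j - k‖ * ‖j - k‖ :=
        (real_inner_le_norm _ _).trans (by gcongr; exact T.le_opNorm _)
      simp only [hV]; nlinarith
    have h2 : 1 / (2 * L) * ‖S^[n] j - S^[n] k‖ ^ 2 ≤ V (S^[n] j - S^[n] k) := by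
      simp only [hV]; linarith [hT (S^[n] j - S^[n] k)]
    have h3 : 0 ≤ (1 - ε) ^ n := pow_nonneg (by linarith) n
    have h4 := h2.trans ((hiter n j k).trans (mul_le_mul_of_nonneg_left h1 h3))
    calc ‖S^[n] j - S^[n] k‖ ^ 2 = 2 * L * (1 / (2 * L) * ‖S^[n] j - S^[n] k‖ ^ 2) := by
          field_simp
      _ ≤ 2 * L * ((1 - ε) ^ n * ((c + 1 / (2 * L)) * ‖j - k‖ ^ 2)) := by gcongr
      _ = _ := by rw [hD]; ring
  -- `S` contracts only the energy. Passing to the norm costs the factor `D`, which a high iterate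
  -- overcomes; the value `1 / 4` for squares gives the contraction constant `1 / 2`.
  obtain ⟨n, hn⟩ : ∃ n : ℕ, (1 - ε) ^ n * D ≤ 1 / 4 := by
    have h := (tendsto_pow_atTop_nhds_zero_of_lt_one (r := 1 - ε) (by linarith)
      (by linarith)).mul_const D
    rw [zero_mul] at h
    exact (h.eventually (ge_mem_nhds (by norm_num : (0 : ℝ) < 1 / 4))).exists
  have hcontr : ContractingWith (1 / 2) S^[n] := by
    refine ⟨by norm_num, LipschitzWith.of_dist_le_mul fun j k => ?_⟩
    rw [dist_eq_norm, dist_eq_norm]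
    refine (pow_le_pow_iff_left₀ (norm_nonneg _) (by positivity) two_ne_zero).1 ?_
    calc ‖S^[n] j - S^[n] k‖ ^ 2 ≤ (1 - ε) ^ n * D * ‖j - k‖ ^ 2 := hnorm n j k
      _ ≤ 1 / 4 * ‖j - k‖ ^ 2 := by gcongr
      _ = _ := by rw [mul_pow]; norm_num
  -- The unique fixed point of an iterate is fixed by `S` itself.
  have hfix := hcontr.isFixedPt_fixedPoint_iterate
  set j := hcontr.fixedPoint with hj
  have h : S j = j := hfix
  have h2 : N (T j) = j := by
    have h3 : ε • (N (T j) - j) = 0 := by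
      have : S j - j = ε • (N (T j) - j) := by simp only [hS]; module
      rw [← this, h, sub_self]
    exact sub_eq_zero.1 ((smul_eq_zero.1 h3).resolve_left hε.ne')
  exact ⟨T j, by rw [h2]⟩

end FixedPoint

/-! ### Cocoercivity of the relativistic velocity -/

section Velocity

lemma one_le_sqrt (z : E3) : 1 ≤ √(1 + ‖z‖ ^ 2) :=
  Real.one_le_sqrt.2 (by nlinarith [sq_nonneg ‖z‖])

lemma smul_vel (z : E3) : √(1 + ‖z‖ ^ 2) • vel z = z := by
  have : √(1 + ‖z‖ ^ 2) ≠ 0 := by linarith [one_le_sqrt z]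
  rw [vel, smul_inv_smul₀ this]

lemma sq_mul_norm_vel_sq (z : E3) : √(1 + ‖z‖ ^ 2) ^ 2 * ‖vel z‖ ^ 2 = √(1 + ‖z‖ ^ 2) ^ 2 - 1 := by
  have h := congrArg (fun w => ‖w‖ ^ 2) (smul_vel z)
  simp only [norm_smul, mul_pow, Real.norm_eq_abs, sq_abs] at h
  rw [h, Real.sq_sqrt (by positivity)]; ring

lemma norm_vel_le_one (z : E3) : ‖vel z‖ ≤ 1 := by
  have h1 := one_le_sqrt z
  have h := sq_mul_norm_vel_sq z
  by_contra! hlt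
  have : 1 < ‖vel z‖ ^ 2 := by nlinarith
  nlinarith [sq_nonneg (√(1 + ‖z‖ ^ 2))]

lemma continuous_vel : Continuous vel := by
  have h : Continuous fun z : E3 => √(1 + ‖z‖ ^ 2) := by fun_prop
  exact (h.inv₀ fun z => (zero_lt_one.trans_le (one_le_sqrt z)).ne').smul continuous_id

/-- The relativistic velocity is cocoercive. -/
lemma norm_vel_sub_sq_le (a b : E3) :
    ‖vel a - vel b‖ ^ 2 ≤ inner ℝ (vel a - vel b) (a - b) := by
  wlog hab : √(1 + ‖b‖ ^ 2) ≤ √(1 + ‖a‖ ^ 2) generalizing a b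
  · have h := this b a (le_of_not_ge hab)
    rwa [norm_sub_rev, ← neg_sub a b, ← neg_sub (vel a) (vel b), inner_neg_neg] at h
  have ha1 := sq_mul_norm_vel_sq a
  have hb1 := sq_mul_norm_vel_sq b
  have ht := one_le_sqrt b
  have e : inner ℝ (vel a - vel b) (a - b) = inner ℝ (vel a - vel b)
      (√(1 + ‖a‖ ^ 2) • vel a - √(1 + ‖b‖ ^ 2) • vel b) := by rw [smul_vel, smul_vel]
  rw [e]
  set s := √(1 + ‖a‖ ^ 2)
  set t := √(1 + ‖b‖ ^ 2)
  set v := vel a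
  set w := vel b
  -- The speed increases with the Lorentz factor, because `‖v‖² = 1 - 1 / s²`.
  have hvw : ‖w‖ ≤ ‖v‖ := by
    refine (sq_le_sq₀ (norm_nonneg _) (norm_nonneg _)).1 ?_
    have h1 : ‖v‖ ^ 2 = 1 - 1 / s ^ 2 := by
      have : s ≠ 0 := by linarith
      field_simp; linarith
    have h2 : ‖w‖ ^ 2 = 1 - 1 / t ^ 2 := by
      have : t ≠ 0 := by linarith
      field_simp; linarith
    rw [h1, h2]
    gcongr
  have hin : inner ℝ v w ≤ ‖v‖ ^ 2 :=
    (real_inner_le_norm v w).trans (by rw [sq]; gcongr)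
  -- This is the splitting `s v - t w = t (v - w) + (s - t) v`; the last term contributes a
  -- nonnegative amount since `s ≥ t` and `⟨v, w⟩ ≤ ‖v‖²`.
  have h1 : inner ℝ (v - w) (s • v - t • w) =
      ‖v - w‖ ^ 2 + (t - 1) * ‖v - w‖ ^ 2 + (s - t) * (‖v‖ ^ 2 - inner ℝ v w) := by
    rw [norm_sub_sq_real]
    simp only [inner_sub_left, inner_sub_right, real_inner_smul_right, real_inner_self_eq_norm_sq,
      real_inner_comm v w]
    ring
  rw [h1]
  have h2 : 0 ≤ (t - 1) * ‖v - w‖ ^ 2 := mul_nonneg (by linarith) (by positivity)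
  have h3 : 0 ≤ (s - t) * (‖v‖ ^ 2 - inner ℝ v w) := mul_nonneg (by linarith) (by linarith)
  linarith

end Velocity

/-! ### Averaging the velocity over momenta -/

section Fiber

variable {φ : E3 → ℝ} {L : ℝ}

lemma integrable_smul_vel (hφ : Integrable φ) (a : E3) :
    Integrable (fun p => φ p • vel (p - a)) := by
  refine Integrable.mono' hφ.norm ?_ ?_
  · exact hφ.aestronglyMeasurable.smul
      (continuous_vel.comp (continuous_id.sub continuous_const)).aestronglyMeasurable
  · refine Eventually.of_forall fun p => ?_
    rw [norm_smul]
    exact mul_le_of_le_one_right (norm_nonneg _) (norm_vel_le_one _)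

lemma norm_integral_smul_vel_le (hφ : Integrable φ) (h0 : ∀ᵐ p, 0 ≤ φ p)
    (hL : ∫ p, φ p ≤ L) (a : E3) : ‖∫ p, φ p • vel (p - a)‖ ≤ L := by
  refine (norm_integral_le_of_norm_le hφ ?_).trans hL
  filter_upwards [h0] with p hp
  rw [norm_smul, Real.norm_of_nonneg hp]
  exact mul_le_of_le_one_right hp (norm_vel_le_one _)

/-- Write `‖D‖²` as the average of `⟨D, w⟩`, where `w` is the difference of velocities, and use `⟨D,
w⟩ ≤ ‖D‖² / (2L) + L / 2 ‖w‖²`. Since the total mass is at most `L`, the first term contributes at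
most half of `‖D‖²`; the second is controlled by pointwise cocoercivity. -/
lemma norm_integral_vel_sub_sq_le (hφ : Integrable φ) (h0 : ∀ᵐ p, 0 ≤ φ p)
    (hL : ∫ p, φ p ≤ L) (hLpos : 0 < L) (a b : E3) :
    ‖(∫ p, φ p • vel (p - a)) - ∫ p, φ p • vel (p - b)‖ ^ 2 ≤
      L * -inner ℝ ((∫ p, φ p • vel (p - a)) - ∫ p, φ p • vel (p - b)) (a - b) := by
  have ia := integrable_smul_vel hφ a
  have ib := integrable_smul_vel hφ b
  have hD : (∫ p, φ p • vel (p - a)) - ∫ p, φ p • vel (p - b) =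
      ∫ p, φ p • (vel (p - a) - vel (p - b)) := by
    rw [← integral_sub ia ib]; simp only [smul_sub]
  have iD : Integrable (fun p => φ p • (vel (p - a) - vel (p - b))) := by
    simp only [smul_sub]; exact ia.sub ib
  rw [hD]
  set D := ∫ p, φ p • (vel (p - a) - vel (p - b)) with hDdef
  have h1 : ∀ c : E3, inner ℝ D c = ∫ p, inner ℝ c (φ p • (vel (p - a) - vel (p - b))) :=
    fun c => by rw [real_inner_comm, integral_inner iD]
  have h2 : ‖D‖ ^ 2 ≤ ∫ p, (φ p * (‖D‖ ^ 2 / (2 * L)) +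
      L / 2 * inner ℝ (b - a) (φ p • (vel (p - a) - vel (p - b)))) := by
    have h0' : ‖D‖ ^ 2 = ∫ p, inner ℝ D (φ p • (vel (p - a) - vel (p - b))) := by
      rw [← h1 D, real_inner_self_eq_norm_sq]
    refine h0'.le.trans (integral_mono_ae (iD.const_inner D)
      ((hφ.mul_const _).add ((iD.const_inner (b - a)).const_mul _)) ?_)
    filter_upwards [h0] with p hp
    rw [real_inner_smul_right, real_inner_smul_right]
    set w := vel (p - a) - vel (p - b) with hw
    have hc : ‖w‖ ^ 2 ≤ inner ℝ (b - a) w := by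
      have := norm_vel_sub_sq_le (p - a) (p - b)
      rwa [sub_sub_sub_cancel_left, real_inner_comm] at this
    have h3 : inner ℝ D w ≤ ‖D‖ ^ 2 / (2 * L) + L / 2 * ‖w‖ ^ 2 := by
      refine (real_inner_le_norm D w).trans ?_
      have : ‖D‖ ^ 2 / (2 * L) + L / 2 * ‖w‖ ^ 2 - ‖D‖ * ‖w‖ =
          (‖D‖ - L * ‖w‖) ^ 2 / (2 * L) := by field_simp; ring
      have h4 : 0 ≤ (‖D‖ - L * ‖w‖) ^ 2 / (2 * L) := by positivity
      linarith
    calc φ p * inner ℝ D w ≤ φ p * (‖D‖ ^ 2 / (2 * L) + L / 2 * inner ℝ (b - a) w) := by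
          gcongr
          exact h3.trans (by gcongr)
      _ = _ := by ring
  rw [integral_add (hφ.mul_const _) ((iD.const_inner (b - a)).const_mul _), integral_mul_const,
    integral_const_mul, ← h1] at h2
  have h3 : (∫ p, φ p) * (‖D‖ ^ 2 / (2 * L)) ≤ L * (‖D‖ ^ 2 / (2 * L)) := by gcongr
  have h4 : L * (‖D‖ ^ 2 / (2 * L)) = ‖D‖ ^ 2 / 2 := by field_simp
  have h5 : inner ℝ D (b - a) = -inner ℝ D (a - b) := by rw [← inner_neg_right, neg_sub]
  rw [h5] at h2
  linarith

end Fiber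

/-! ### Charge and current densities of a phase space density -/

section PhaseDensity

/-- The properties of a bounded compactly supported phase space density that are used below:
almost every fiber is nonnegative with integral at most `L`, and vanishes outside a ball. -/
structure IsPhaseDensity (f : E3 × E3 → ℝ) (R L : ℝ) : Prop where
  integrable : Integrable f
  pos : 0 < L
  fiber_integrable : ∀ᵐ y, Integrable (fun p => f (y, p))
  fiber_nonneg : ∀ᵐ y, ∀ᵐ p, 0 ≤ f (y, p)
  fiber_le : ∀ᵐ y, ∫ p, f (y, p) ≤ L
  fiber_zero : ∀ᵐ y, y ∉ closedBall (0 : E3) R → ∀ᵐ p, f (y, p) = 0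

lemma exists_isPhaseDensity {f : E3 × E3 → ℝ} (hf_Linfty : MemLp f ∞ volume)
    (hf_nonneg : ∀ᵐ z, 0 ≤ f z)
    (hf_supp : ∃ K : Set (E3 × E3), IsCompact K ∧ ∀ᵐ z, z ∉ K → f z = 0) :
    ∃ R L, IsPhaseDensity f R L := by
  obtain ⟨K, hK, hKf⟩ := hf_supp
  obtain ⟨R, hR⟩ := hK.isBounded.subset_closedBall 0
  set M : ℝ := (eLpNorm f ∞ volume).toReal with hM
  have hM0 : 0 ≤ M := ENNReal.toReal_nonneg
  have hbd : ∀ᵐ z, ‖f z‖ ≤ M := by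
    have h := ae_le_eLpNormEssSup (f := f) (μ := volume)
    filter_upwards [h] with z hz
    have h2 := ENNReal.toReal_mono (by simpa using hf_Linfty.2.ne) hz
    simpa [hM] using h2
  set B : Set E3 := closedBall 0 R with hB
  have hsub : K ⊆ B ×ˢ B := by
    rw [hB, closedBall_prod_same]; exact hR
  have hfin : volume B < ∞ := measure_closedBall_lt_top
  have hle : ∀ᵐ z, ‖f z‖ ≤ (B ×ˢ B).indicator (fun _ => M) z := by
    filter_upwards [hbd, hKf] with z h1 h2
    by_cases hz : z ∈ B ×ˢ B
    · rwa [indicator_of_mem hz]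
    · rw [indicator_of_notMem hz, h2 fun h => hz (hsub h), norm_zero]
  have hBm : MeasurableSet B := measurableSet_closedBall
  have hint : Integrable f := by
    refine Integrable.mono' ?_ hf_Linfty.1 hle
    rw [integrable_indicator_iff (hBm.prod hBm), integrableOn_const_iff]
    right
    rw [Measure.volume_eq_prod, Measure.prod_prod]
    exact ENNReal.mul_lt_top hfin hfin
  rw [Measure.volume_eq_prod] at hle hf_nonneg hint
  -- Adding one keeps the bound strictly positive when `f` vanishes.
  refine ⟨R, M * volume.real B + 1, hint, by positivity, hint.prod_right_ae,
    Measure.ae_ae_of_ae_prod hf_nonneg, ?_, ?_⟩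
  · filter_upwards [Measure.ae_ae_of_ae_prod hle] with y hy
    have hi : Integrable (B.indicator fun _ : E3 => M) := by
      rw [integrable_indicator_iff hBm, integrableOn_const_iff]; right; exact hfin
    have h1 : ∫ p, f (y, p) ≤ ∫ p, B.indicator (fun _ => M) p := by
      refine (Real.le_norm_self _).trans (norm_integral_le_of_norm_le hi ?_)
      filter_upwards [hy] with p hp
      refine hp.trans ?_
      by_cases hpB : p ∈ B
      · rw [indicator_of_mem hpB]
        exact indicator_le_self' (fun _ _ => hM0) _
      · rw [indicator_of_notMem fun h => hpB h.2]
        exact indicator_nonneg (fun _ _ => hM0) _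
    rw [integral_indicator hBm] at h1
    simp at h1
    linarith
  · filter_upwards [Measure.ae_ae_of_ae_prod hle] with y hy hyB
    filter_upwards [hy] with p hp
    rw [indicator_of_notMem fun h => hyB h.1] at hp
    exact norm_le_zero_iff.1 hp

variable {f : E3 × E3 → ℝ} {R L : ℝ}

lemma IsPhaseDensity.isDensity_rho (hf : IsPhaseDensity f R L) : IsDensity (rho f) R L where
  meas := hf.integrable.aestronglyMeasurable.integral_prod_right'
  nonneg := hf.pos.le
  bound := by
    filter_upwards [hf.fiber_nonneg, hf.fiber_le] with y h1 h2
    rwa [rho, Real.norm_of_nonneg (integral_nonneg_of_ae h1)]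
  supp := by
    filter_upwards [hf.fiber_zero] with y h1 hy
    rw [rho, integral_congr_ae (h1 hy), integral_zero]

lemma IsPhaseDensity.aestronglyMeasurable_smul_velA (hf : IsPhaseDensity f R L) {A : E3 → E3}
    (hA : AEStronglyMeasurable A volume) :
    AEStronglyMeasurable (fun q : E3 × E3 => f q • velA A q.1 q.2) (volume.prod volume) := by
  have h1 : AEStronglyMeasurable (fun q : E3 × E3 => q.2 - A q.1) (volume.prod volume) :=
    continuous_snd.aestronglyMeasurable.sub hA.comp_fst
  exact hf.integrable.aestronglyMeasurable.smul (continuous_vel.comp_aestronglyMeasurable h1)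

/-- Measurability is asked of the current and not of `A`, since an arbitrary solution of the
integral equation is not known beforehand to be measurable. -/
lemma IsPhaseDensity.isDensity_current_of_aestronglyMeasurable (hf : IsPhaseDensity f R L)
    {A : E3 → E3} (hA : AEStronglyMeasurable (current f A) volume) :
    IsDensity (current f A) R L where
  meas := hA
  nonneg := hf.pos.le
  bound := by
    filter_upwards [hf.fiber_integrable, hf.fiber_nonneg, hf.fiber_le] with y h0 h1 h2
    exact norm_integral_smul_vel_le h0 h1 h2 (A y)
  supp := by
    filter_upwards [hf.fiber_zero] with y h1 hy
    have : ∀ᵐ p, f (y, p) • velA A y p = 0 := by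
      filter_upwards [h1 hy] with p hp
      rw [hp, zero_smul]
    rw [current, integral_congr_ae this, integral_zero]

lemma IsPhaseDensity.isDensity_current (hf : IsPhaseDensity f R L) {A : E3 → E3}
    (hA : AEStronglyMeasurable A volume) : IsDensity (current f A) R L :=
  hf.isDensity_current_of_aestronglyMeasurable
    (hf.aestronglyMeasurable_smul_velA hA).integral_prod_right'

/-- The exceptional null set depends on `f` only, hence the quantifiers over `A` and `A'` stand
inside. -/
lemma IsPhaseDensity.norm_current_sub_sq_le (hf : IsPhaseDensity f R L) :
    ∀ᵐ y, ∀ A A' : E3 → E3, ‖current f A y - current f A' y‖ ^ 2 ≤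
      L * -inner ℝ (current f A y - current f A' y) (A y - A' y) := by
  filter_upwards [hf.fiber_integrable, hf.fiber_nonneg, hf.fiber_le] with y h0 h1 h2 A A'
  exact norm_integral_vel_sub_sq_le h0 h1 h2 hf.pos (A y) (A' y)

end PhaseDensity

/-! ### Algebra of the Darwin kernel -/

section DarwinKernel

/-- The kernel of the vector potential as a function of `z = y - x`. -/
noncomputable def darwin (z v : E3) : E3 := dipole ‖z‖⁻¹ (‖z‖⁻¹ ^ 3) z v

lemma darwin_eq_regularization (z v : E3) :
    darwin z v = dipole (invDist 0 z) (invDist 0 z ^ 3) z v := by rw [darwin, invDist_zero]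

lemma darwinKernel_eq (x y j : E3) : darwinKernel x y j = darwin (y - x) j := by
  unfold darwinKernel darwin dipole omega
  rw [real_inner_smul_left]
  module

lemma darwin_neg (z v : E3) : darwin (-z) v = darwin z v := by
  simp [darwin, dipole]

lemma darwin_add (z v w : E3) : darwin z (v + w) = darwin z v + darwin z w := by
  simp only [darwin, dipole, inner_add_right]; module

lemma darwin_smul (z : E3) (c : ℝ) (v : E3) : darwin z (c • v) = c • darwin z v := by
  simp only [darwin, dipole, real_inner_smul_right]; module

lemma inner_darwin_left (z v w : E3) : inner ℝ (darwin z v) w = inner ℝ v (darwin z w) := by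
  simp only [darwin, dipole, inner_add_left, inner_add_right, real_inner_smul_left,
    real_inner_smul_right, real_inner_comm z v]
  ring

lemma norm_darwin_le (z v : E3) : ‖darwin z v‖ ≤ 2 * (‖z‖⁻¹ * ‖v‖) := by
  refine (norm_dipole_le _ _ _ _).trans ?_
  rw [abs_pow, abs_inv, abs_norm]
  rcases eq_or_ne z 0 with rfl | hz
  · simp
  · have hs : ‖z‖ ≠ 0 := norm_ne_zero_iff.2 hz
    have : ‖z‖⁻¹ + ‖z‖⁻¹ ^ 3 * ‖z‖ ^ 2 = 2 * ‖z‖⁻¹ := by field_simp; norm_num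
    rw [this, mul_assoc]

lemma measurable_darwin : Measurable fun q : E3 × E3 => darwin q.1 q.2 := by
  unfold darwin dipole
  fun_prop

end DarwinKernel

/-! ### The Darwin operator on square integrable currents in a ball -/

section Operator

/-- Lebesgue measure on a ball centered at the origin. -/
noncomputable def ballMeasure (R : ℝ) : Measure E3 := volume.restrict (closedBall 0 R)

instance (R : ℝ) : IsFiniteMeasure (ballMeasure R) :=
  ⟨by rw [ballMeasure, Measure.restrict_apply_univ]; exact measure_closedBall_lt_top⟩

instance (R : ℝ) : NullSingletonClass (ballMeasure R) := by unfold ballMeasure; infer_instance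

variable {R : ℝ}

lemma integrable_inv_norm_sq (R : ℝ) (x : E3) :
    Integrable (fun y => ‖y - x‖⁻¹ ^ 2) (ballMeasure R) := by
  refine Integrable.mono' (integrableOn_weight_translate R x)
    (Measurable.aestronglyMeasurable (by fun_prop)) (Eventually.of_forall fun y => ?_)
  rw [Real.norm_of_nonneg (by positivity)]
  exact inv_norm_sq_le_weight _

lemma memLp_inv_norm (R : ℝ) (x : E3) :
    MemLp (fun y => ‖y - x‖⁻¹) 2 (ballMeasure R) :=
  (memLp_two_iff_integrable_sq (Measurable.aestronglyMeasurable (by fun_prop))).2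
    (integrable_inv_norm_sq R x)

lemma norm_sq_eq_integral {μ : Measure E3} (j : Lp E3 2 μ) : ‖j‖ ^ 2 = ∫ y, ‖j y‖ ^ 2 ∂μ := by
  rw [← real_inner_self_eq_norm_sq, L2.inner_def]
  simp only [real_inner_self_eq_norm_sq]

lemma integrable_inv_norm_mul (j : Lp E3 2 (ballMeasure R)) (x : E3) :
    Integrable (fun y => ‖y - x‖⁻¹ * ‖j y‖) (ballMeasure R) :=
  (memLp_inv_norm R x).integrable_mul (Lp.memLp j).norm

/-- Cauchy–Schwarz, with `‖y - x‖⁻¹` square integrable over the ball uniformly in `x`. Thus square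
integrable currents have bounded potentials. -/
lemma integral_inv_norm_mul_le (j : Lp E3 2 (ballMeasure R)) (x : E3) :
    ∫ y, ‖y - x‖⁻¹ * ‖j y‖ ∂(ballMeasure R) ≤ √(weightBound R) * ‖j‖ := by
  have h := integral_mul_le_Lp_mul_Lq_of_nonneg (μ := ballMeasure R) Real.HolderConjugate.two_two
    (f := fun y => ‖y - x‖⁻¹) (g := fun y => ‖j y‖)
    (Eventually.of_forall fun y => by positivity) (Eventually.of_forall fun y => by positivity)
    (by simpa using memLp_inv_norm R x) (by simpa using (Lp.memLp j).norm)
  simp only [Real.rpow_two, ← Real.sqrt_eq_rpow, ← norm_sq_eq_integral,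
    Real.sqrt_sq (norm_nonneg j)] at h
  refine h.trans ?_
  gcongr
  exact (integral_mono (integrable_inv_norm_sq R x) (integrableOn_weight_translate R x)
    fun y => inv_norm_sq_le_weight _).trans (setIntegral_weight_translate_le R x)

lemma aestronglyMeasurable_darwin {μ : Measure E3} {j : E3 → E3} (hj : AEStronglyMeasurable j μ)
    (x : E3) : AEStronglyMeasurable (fun y => darwin (y - x) (j y)) μ := by
  have h : AEMeasurable (fun y => (y - x, j y)) μ :=
    AEMeasurable.prodMk (by fun_prop) hj.aemeasurable
  exact (measurable_darwin.comp_aemeasurable h).aestronglyMeasurable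

lemma integrable_darwin (j : Lp E3 2 (ballMeasure R)) (x : E3) :
    Integrable (fun y => darwin (y - x) (j y)) (ballMeasure R) :=
  Integrable.mono' ((integrable_inv_norm_mul j x).const_mul 2)
    (aestronglyMeasurable_darwin (Lp.aestronglyMeasurable j) x)
    (Eventually.of_forall fun _ => norm_darwin_le _ _)

/-- The vector potential of a current density in a ball. -/
noncomputable def ballPotential (R : ℝ) (j : E3 → E3) (x : E3) : E3 :=
  (1 / 2 : ℝ) • ∫ y, darwin (y - x) (j y) ∂(ballMeasure R)

lemma ballPotential_congr {j k : E3 → E3} (h : j =ᵐ[ballMeasure R] k) (x : E3) :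
    ballPotential R j x = ballPotential R k x := by
  unfold ballPotential
  congr 1
  refine integral_congr_ae ?_
  filter_upwards [h] with y hy
  simp only [hy]

lemma norm_ballPotential_le (j : Lp E3 2 (ballMeasure R)) (x : E3) :
    ‖ballPotential R j x‖ ≤ √(weightBound R) * ‖j‖ := by
  have h := norm_integral_le_of_norm_le ((integrable_inv_norm_mul j x).const_mul 2)
    (Eventually.of_forall fun y => norm_darwin_le (y - x) (j y))
  rw [integral_const_mul] at h
  have h2 := integral_inv_norm_mul_le j x
  rw [ballPotential, norm_smul, Real.norm_of_nonneg (by norm_num)]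
  linarith

lemma aestronglyMeasurable_ballPotential (j : Lp E3 2 (ballMeasure R)) :
    AEStronglyMeasurable (ballPotential R j) (ballMeasure R) := by
  have h : AEMeasurable (fun q : E3 × E3 => (q.2 - q.1, j q.2))
      ((ballMeasure R).prod (ballMeasure R)) :=
    AEMeasurable.prodMk (by fun_prop) (Lp.aestronglyMeasurable j).comp_snd.aemeasurable
  have h2 := (measurable_darwin.comp_aemeasurable h).aestronglyMeasurable
  exact h2.integral_prod_right'.const_smul (1 / 2 : ℝ)

lemma memLp_ballPotential (j : Lp E3 2 (ballMeasure R)) :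
    MemLp (ballPotential R j) 2 (ballMeasure R) :=
  MemLp.of_bound (aestronglyMeasurable_ballPotential j) _
    (Eventually.of_forall (norm_ballPotential_le j))

/-- The operator mapping a square integrable current density in a ball to its potential. -/
noncomputable def potentialOperator (R : ℝ) :
    Lp E3 2 (ballMeasure R) →L[ℝ] Lp E3 2 (ballMeasure R) :=
  LinearMap.mkContinuous
    { toFun := fun j => (memLp_ballPotential j).toLp
      map_add' := fun j k => by
        rw [← MemLp.toLp_add]
        refine MemLp.toLp_congr _ _ (Eventually.of_forall fun x => ?_)
        rw [ballPotential_congr (Lp.coeFn_add j k), Pi.add_apply]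
        unfold ballPotential
        rw [← smul_add, ← integral_add (integrable_darwin j x) (integrable_darwin k x)]
        simp only [Pi.add_apply, darwin_add]
      map_smul' := fun c j => by
        rw [RingHom.id_apply, ← MemLp.toLp_const_smul]
        refine MemLp.toLp_congr _ _ (Eventually.of_forall fun x => ?_)
        rw [ballPotential_congr (Lp.coeFn_smul c j), Pi.smul_apply]
        unfold ballPotential
        simp only [Pi.smul_apply, darwin_smul, integral_smul]
        exact smul_comm _ _ _ }
    (measureUnivNNReal (ballMeasure R) ^ (2 : ℝ≥0∞).toReal⁻¹ * √(weightBound R)) fun j => by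
      have h := Lp.norm_le_of_ae_bound (f := (memLp_ballPotential j).toLp)
        (C := √(weightBound R) * ‖j‖) (by positivity) (by
          filter_upwards [(memLp_ballPotential j).coeFn_toLp] with x hx
          rw [hx]; exact norm_ballPotential_le j x)
      rwa [← mul_assoc] at h

lemma potentialOperator_ae (j : Lp E3 2 (ballMeasure R)) :
    potentialOperator R j =ᵐ[ballMeasure R] ballPotential R j :=
  (memLp_ballPotential j).coeFn_toLp

lemma integrable_inv_norm_mul_mul (j k : Lp E3 2 (ballMeasure R)) :
    Integrable (fun q : E3 × E3 => ‖j q.1‖ * ‖k q.2‖ * ‖q.1 - q.2‖⁻¹)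
      ((ballMeasure R).prod (ballMeasure R)) := by
  have hm : AEStronglyMeasurable (fun q : E3 × E3 => ‖j q.1‖ * ‖k q.2‖ * ‖q.1 - q.2‖⁻¹)
      ((ballMeasure R).prod (ballMeasure R)) :=
    ((Lp.aestronglyMeasurable j).comp_fst.norm.mul
      (Lp.aestronglyMeasurable k).comp_snd.norm).mul
      (Measurable.aestronglyMeasurable (by fun_prop))
  have he : ∀ x y : E3, ‖j x‖ * ‖k y‖ * ‖x - y‖⁻¹ = ‖j x‖ * (‖y - x‖⁻¹ * ‖k y‖) := fun x y => by
    rw [norm_sub_rev]; ring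
  refine (integrable_prod_iff hm).2 ⟨Eventually.of_forall fun x => ?_, ?_⟩
  · simp only [he]
    exact (integrable_inv_norm_mul k x).const_mul _
  · have hj : Integrable (fun x => ‖j x‖) (ballMeasure R) :=
      ((Lp.memLp j).integrable one_le_two).norm
    refine Integrable.mono' (hj.mul_const (√(weightBound R) * ‖k‖)) hm.norm.integral_prod_right'
      (Eventually.of_forall fun x => ?_)
    rw [Real.norm_of_nonneg (integral_nonneg fun _ => norm_nonneg _)]
    simp only [norm_mul, norm_norm, norm_inv]
    simp only [he]
    rw [integral_const_mul]
    gcongr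
    exact integral_inv_norm_mul_le k x

lemma integrable_inner_darwin (j k : Lp E3 2 (ballMeasure R)) :
    Integrable (fun q : E3 × E3 => (inner ℝ (k q.1) (darwin (q.1 - q.2) (j q.2)) : ℝ))
      ((ballMeasure R).prod (ballMeasure R)) := by
  refine Integrable.mono' ((integrable_inv_norm_mul_mul k j).const_mul 2) ?_
    (Eventually.of_forall fun q => ?_)
  · have h : AEMeasurable (fun q : E3 × E3 => (q.1 - q.2, j q.2))
        ((ballMeasure R).prod (ballMeasure R)) :=
      AEMeasurable.prodMk (by fun_prop) (Lp.aestronglyMeasurable j).comp_snd.aemeasurable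
    exact (Lp.aestronglyMeasurable k).comp_fst.inner
      (measurable_darwin.comp_aemeasurable h).aestronglyMeasurable
  · refine (norm_inner_le_norm _ _).trans ?_
    calc ‖k q.1‖ * ‖darwin (q.1 - q.2) (j q.2)‖
        ≤ ‖k q.1‖ * (2 * (‖q.1 - q.2‖⁻¹ * ‖j q.2‖)) := by gcongr; exact norm_darwin_le _ _
      _ = _ := by ring

lemma inner_potentialOperator (j k : Lp E3 2 (ballMeasure R)) :
    inner ℝ (potentialOperator R j) k =
      1 / 2 * ∫ q, inner ℝ (k q.1) (darwin (q.1 - q.2) (j q.2))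
        ∂((ballMeasure R).prod (ballMeasure R)) := by
  rw [L2.inner_def, integral_prod _ (integrable_inner_darwin j k), ← integral_const_mul]
  refine integral_congr_ae ?_
  filter_upwards [potentialOperator_ae j] with x hx
  rw [hx, real_inner_comm, ballPotential, real_inner_smul_right,
    ← integral_inner (integrable_darwin j x)]
  congr 1
  congr 1
  ext y
  rw [← darwin_neg (y - x), neg_sub]

/-- The kernel is an even function of `x - y` with values in symmetric matrices. -/
lemma potentialOperator_symm (j k : Lp E3 2 (ballMeasure R)) :
    inner ℝ (potentialOperator R j) k = inner ℝ j (potentialOperator R k) := by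
  rw [← real_inner_comm j, inner_potentialOperator, inner_potentialOperator,
    ← integral_prod_swap fun q : E3 × E3 => (inner ℝ (j q.1) (darwin (q.1 - q.2) (k q.2)) : ℝ)]
  congr 1
  congr 1
  ext q
  rw [real_inner_comm, inner_darwin_left, ← darwin_neg, neg_sub]
  rfl

lemma potentialOperator_nonneg (j : Lp E3 2 (ballMeasure R)) :
    0 ≤ inner ℝ (potentialOperator R j) j := by
  rw [inner_potentialOperator]
  refine mul_nonneg (by norm_num) ?_
  exact integral_inner_dipole_nonneg ((Lp.memLp j).integrable one_le_two)
    (integrable_inv_norm_mul_mul j j)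

end Operator

/-! ### Regularity of the vector potential of a density -/

section Potentials

variable {g : E3 → E3} {R M : ℝ}

lemma darwinKernel_eq_regularization (x y j : E3) :
    darwinKernel x y j = dipole (invDist 0 (y - x)) (invDist 0 (y - x) ^ 3) (y - x) j := by
  rw [darwinKernel_eq, darwin_eq_regularization]

lemma IsDensity.integrable_darwinKernel (hg : IsDensity g R M) (x : E3) :
    Integrable (fun y => darwinKernel x y (g y)) := by
  simp only [darwinKernel_eq_regularization]
  exact isRegularization_dipole.integrable_zero hg x

/-- The gradient of the vector potential of a density. -/
noncomputable def potentialDeriv (g : E3 → E3) (x : E3) : E3 →L[ℝ] E3 :=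
  (1 / 2 : ℝ) • -∫ y, dipoleDeriv (invDist 0 (y - x) ^ 3) (invDist 0 (y - x) ^ 5) (y - x) (g y)

lemma IsDensity.hasFDerivAt_potential (hg : IsDensity g R M) (x : E3) :
    HasFDerivAt (fun x => (1 / 2 : ℝ) • ∫ y, darwinKernel x y (g y)) (potentialDeriv g x) x := by
  simp only [darwinKernel_eq_regularization]
  exact (isRegularization_dipole.hasFDerivAt_integral isRegularization_dipoleDeriv
    (fun ε hε z v => hasFDerivAt_dipole hε z v) hg x).const_smul (1 / 2 : ℝ)

lemma IsDensity.continuous_potentialDeriv (hg : IsDensity g R M) :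
    Continuous (potentialDeriv g) :=
  (isRegularization_dipoleDeriv.continuous_integral_zero hg).neg.const_smul (1 / 2 : ℝ)

lemma IsDensity.norm_potentialDeriv_le (hg : IsDensity g R M) (x : E3) :
    ‖potentialDeriv g x‖ ≤ 24 * M * weightBound R := by
  have h := isRegularization_dipoleDeriv.norm_integral_le hg x
  rw [potentialDeriv, norm_smul, norm_neg]
  norm_num at h ⊢
  linarith [norm_nonneg (∫ y, dipoleDeriv (invDist 0 (y - x) ^ 3) (invDist 0 (y - x) ^ 5)
    (y - x) (g y))]

lemma IsDensity.norm_potential_le (hg : IsDensity g R M) (x : E3) :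
    ‖(1 / 2 : ℝ) • ∫ y, darwinKernel x y (g y)‖ ≤ 4 * M * weightBound R := by
  have h := isRegularization_dipole.norm_integral_le hg x
  simp only [← darwinKernel_eq_regularization] at h
  rw [norm_smul]
  norm_num at h ⊢
  linarith [norm_nonneg (∫ y, darwinKernel x y (g y))]

lemma IsDensity.apply_potentialDeriv (hg : IsDensity g R M) (ℓ : (E3 →L[ℝ] E3) →L[ℝ] ℝ)
    (x : E3) : ℓ (potentialDeriv g x) = 1 / 2 * ∫ y,
      -ℓ (dipoleDeriv (‖y - x‖⁻¹ ^ 3) (‖y - x‖⁻¹ ^ 5) (y - x) (g y)) := by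
  have hi := isRegularization_dipoleDeriv.integrable_zero hg x
  rw [potentialDeriv, map_smul, map_neg, ← ℓ.integral_comp_comm hi, ← integral_neg, smul_eq_mul]
  simp only [invDist_zero]

lemma IsDensity.memLp (hg : IsDensity g R M) : MemLp g 2 (ballMeasure R) :=
  MemLp.of_bound hg.meas.restrict M (ae_restrict_of_ae hg.bound)

lemma IsDensity.ballPotential_eq (hg : IsDensity g R M) (x : E3) :
    ballPotential R g x = (1 / 2 : ℝ) • ∫ y, darwinKernel x y (g y) := by
  unfold ballPotential ballMeasure
  congr 1
  simp only [darwinKernel_eq]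
  rw [← integral_indicator measurableSet_closedBall]
  refine integral_congr_ae ?_
  filter_upwards [hg.supp] with y hy
  by_cases h : y ∈ closedBall (0 : E3) R
  · rw [indicator_of_mem h]
  · rw [indicator_of_notMem h, hy h]
    simp [darwin, dipole]

lemma IsDensity.potentialOperator_ae (hg : IsDensity g R M) :
    potentialOperator R hg.memLp.toLp =ᵐ[ballMeasure R]
      fun x => (1 / 2 : ℝ) • ∫ y, darwinKernel x y (g y) := by
  filter_upwards [RVD.potentialOperator_ae (hg.memLp.toLp)] with x hx
  rw [hx, ballPotential_congr hg.memLp.coeFn_toLp, hg.ballPotential_eq]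

/-- For a unit vector `ω` the matrix `id + ω ⊗ ω` has inverse `id - ½ ω ⊗ ω`, so `g` can be
recovered from the integrand away from `y = x`. -/
lemma aestronglyMeasurable_of_darwinKernel {x : E3}
    (h : AEStronglyMeasurable (fun y => darwinKernel x y (g y)) volume) :
    AEStronglyMeasurable g volume := by
  have hω : Measurable (omega x) := by unfold omega; fun_prop
  have h1 : AEStronglyMeasurable (fun y => ‖y - x‖ • (darwinKernel x y (g y) -
      (1 / 2 * inner ℝ (omega x y) (darwinKernel x y (g y)) : ℝ) • omega x y)) volume := by
    have hm := hω.aestronglyMeasurable (μ := volume)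
    have hn : AEStronglyMeasurable (fun y : E3 => ‖y - x‖) volume :=
      Continuous.aestronglyMeasurable (by fun_prop)
    exact hn.smul (h.sub (((hm.inner (𝕜 := ℝ) h).const_mul (1 / 2)).smul hm))
  refine h1.congr ?_
  filter_upwards [ae_sub_ne_zero x] with y hy
  have hs : ‖y - x‖ ≠ 0 := norm_ne_zero_iff.2 hy
  have hω1 : inner ℝ (omega x y) (omega x y) = (1 : ℝ) := by
    rw [real_inner_self_eq_norm_sq, omega, norm_smul, norm_inv, norm_norm, inv_mul_cancel₀ hs,
      one_pow]
  simp only [darwinKernel, real_inner_smul_right, inner_add_right, hω1, smul_sub, smul_smul,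
    smul_add]
  rw [mul_inv_cancel₀ hs, one_smul]
  have : ‖y - x‖ * (1 / 2 * (‖y - x‖⁻¹ * inner ℝ (omega x y) (g y) +
      ‖y - x‖⁻¹ * inner ℝ (omega x y) (g y) * 1)) = inner ℝ (omega x y) (g y) := by field_simp; ring
  rw [this]
  simp [mul_inv_cancel_left₀ hs]

end Potentials

/-! ### Existence and uniqueness of the vector potential -/

section WellPosed

variable {f : E3 × E3 → ℝ} {R L : ℝ}

lemma IsPhaseDensity.norm_toLp_current_sub_sq_le (hf : IsPhaseDensity f R L) {A A' : E3 → E3}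
    (hA : IsDensity (current f A) R L) (hA' : IsDensity (current f A') R L)
    {a : Lp E3 2 (ballMeasure R)} (ha : a =ᵐ[ballMeasure R] fun y => A y - A' y) :
    ‖hA.memLp.toLp - hA'.memLp.toLp‖ ^ 2 ≤
      L * -inner ℝ (hA.memLp.toLp - hA'.memLp.toLp) a := by
  rw [norm_sq_eq_integral, L2.inner_def, ← integral_neg, ← integral_const_mul]
  refine integral_mono_ae ?_ ((L2.integrable_inner _ _).neg.const_mul L) ?_
  · have h := L2.integrable_inner (𝕜 := ℝ) (hA.memLp.toLp - hA'.memLp.toLp)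
      (hA.memLp.toLp - hA'.memLp.toLp)
    simpa only [real_inner_self_eq_norm_sq] using h
  · filter_upwards [ha, Lp.coeFn_sub hA.memLp.toLp hA'.memLp.toLp, hA.memLp.coeFn_toLp,
      hA'.memLp.coeFn_toLp, ae_restrict_of_ae hf.norm_current_sub_sq_le] with y h1 h2 h3 h4 h5
    rw [h1, h2, Pi.sub_apply, h3, h4]
    exact h5 A A'

/-- Outside the ball almost every momentum fiber of `f` vanishes, so only the values of the
potential inside matter. -/
lemma IsPhaseDensity.current_congr (hf : IsPhaseDensity f R L) {A A' : E3 → E3}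
    (h : A =ᵐ[ballMeasure R] A') (hA : IsDensity (current f A) R L) :
    current f A' =ᵐ[volume] current f A := by
  have h' := (ae_restrict_iff' measurableSet_closedBall).1 h
  filter_upwards [h', hA.supp, hf.fiber_zero] with y h1 h2 h3
  by_cases hy : y ∈ closedBall (0 : E3) R
  · simp only [current, velA, h1 hy]
  · rw [h2 hy]
    have : ∀ᵐ p, f (y, p) • velA A' y p = 0 := by
      filter_upwards [h3 hy] with p hp
      rw [hp, zero_smul]
    rw [current, integral_congr_ae this, integral_zero]

lemma IsDensity.congr {V : Type*} [NormedAddCommGroup V] {g g' : E3 → V} {M : ℝ}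
    (hg : IsDensity g R M) (h : g' =ᵐ[volume] g) : IsDensity g' R M where
  meas := hg.meas.congr h.symm
  nonneg := hg.nonneg
  bound := by filter_upwards [hg.bound, h] with y h1 h2; rwa [h2]
  supp := by filter_upwards [hg.supp, h] with y h1 h2; rwa [h2]

theorem IsPhaseDensity.exists_isVectorPotential (hf : IsPhaseDensity f R L) :
    ∃ A, IsVectorPotential f A ∧ IsDensity (current f A) R L := by
  have hd : ∀ a : Lp E3 2 (ballMeasure R), IsDensity (current f a) R L := fun a =>
    hf.isDensity_current (Lp.stronglyMeasurable a).aestronglyMeasurable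
  obtain ⟨a, ha⟩ := exists_fixedPoint_of_cocoercive (T := potentialOperator R)
    potentialOperator_symm potentialOperator_nonneg (N := fun a => (hd a).memLp.toLp) hf.pos
    (fun a b => hf.norm_toLp_current_sub_sq_le (hd a) (hd b) (Lp.coeFn_sub a b))
  have h1 := (hd a).potentialOperator_ae
  rw [ha] at h1
  have h2 := hf.current_congr h1 (hd a)
  -- The fixed point `a` is only a class on the ball. The witness is the potential of its current,
  -- defined at every point; it agrees with `a` almost everywhere in the ball, so it has the same
  -- current and solves the equation everywhere.
  refine ⟨_, fun x => ⟨((hd a).congr h2).integrable_darwinKernel x, ?_⟩, (hd a).congr h2⟩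
  congr 1
  refine integral_congr_ae ?_
  filter_upwards [h2] with y hy
  rw [hy]

lemma IsPhaseDensity.isDensity_of_isVectorPotential (hf : IsPhaseDensity f R L) {A : E3 → E3}
    (hA : IsVectorPotential f A) : IsDensity (current f A) R L :=
  hf.isDensity_current_of_aestronglyMeasurable
    (aestronglyMeasurable_of_darwinKernel (hA 0).1.aestronglyMeasurable)

theorem IsPhaseDensity.isVectorPotential_unique (hf : IsPhaseDensity f R L) {A A' : E3 → E3}
    (hA : IsVectorPotential f A) (hA' : IsVectorPotential f A') : A' = A := by
  have hd := hf.isDensity_of_isVectorPotential hA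
  have hd' := hf.isDensity_of_isVectorPotential hA'
  set d := hd.memLp.toLp - hd'.memLp.toLp with hddef
  have hT : potentialOperator R d =ᵐ[ballMeasure R] fun y => A y - A' y := by
    rw [hddef, map_sub]
    filter_upwards [Lp.coeFn_sub (potentialOperator R hd.memLp.toLp)
      (potentialOperator R hd'.memLp.toLp), hd.potentialOperator_ae,
      hd'.potentialOperator_ae] with y h1 h2 h3
    rw [h1, Pi.sub_apply, h2, h3, ← (hA y).2, ← (hA' y).2]
  have h1 := hf.norm_toLp_current_sub_sq_le hd hd' hT
  rw [← hddef, real_inner_comm] at h1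
  -- Cocoercivity gives `‖d‖² ≤ -L ⟨T d, d⟩`, and positivity of `T` forces `d = 0`. Equal currents
  -- then give equal potentials at every point.
  have h2 := mul_nonneg hf.pos.le (potentialOperator_nonneg d)
  have h3 : ‖d‖ ^ 2 ≤ 0 := by linarith
  have h4 : d = 0 := by
    rw [← norm_eq_zero]
    exact pow_eq_zero_iff two_ne_zero |>.1 (le_antisymm h3 (sq_nonneg _))
  have h5 : current f A =ᵐ[ballMeasure R] current f A' :=
    (MemLp.toLp_eq_toLp_iff _ _).1 (sub_eq_zero.1 h4)
  have h6 := (ae_restrict_iff' measurableSet_closedBall).1 h5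
  have h7 : current f A =ᵐ[volume] current f A' := by
    filter_upwards [h6, hd.supp, hd'.supp] with y e1 e2 e3
    by_cases hy : y ∈ closedBall (0 : E3) R
    · exact e1 hy
    · rw [e2 hy, e3 hy]
  ext1 x
  rw [(hA x).2, (hA' x).2]
  congr 1
  refine integral_congr_ae ?_
  filter_upwards [h7] with y hy
  rw [hy]

end WellPosed

/-! ### Regularity of the scalar potential -/

section ScalarPotential

variable {g : E3 → ℝ} {R M : ℝ}

lemma div_norm_eq_regularization (x y : E3) (c : ℝ) :
    c / ‖y - x‖ = c * invDist 0 (y - x) := by rw [invDist_zero, div_eq_mul_inv]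

lemma IsDensity.integrable_div_norm (hg : IsDensity g R M) (x : E3) :
    Integrable (fun y => g y / ‖y - x‖) := by
  simp only [div_norm_eq_regularization]
  exact isRegularization_coulomb.integrable_zero hg x

lemma IsDensity.abs_scalarPotential_le (hg : IsDensity g R M) (x : E3) :
    |∫ y, g y / ‖y - x‖| ≤ 1 * M * weightBound R := by
  simp only [div_norm_eq_regularization]
  exact isRegularization_coulomb.norm_integral_le hg x

/-- The derivative of the scalar potential of a density. -/
noncomputable def scalarPotentialDeriv (g : E3 → ℝ) (x : E3) : E3 →L[ℝ] ℝ :=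
  -∫ y, (-(g y * invDist 0 (y - x) ^ 3)) • innerSL ℝ (y - x)

lemma IsDensity.hasFDerivAt_scalarPotential (hg : IsDensity g R M) (x : E3) :
    HasFDerivAt (fun x => ∫ y, g y / ‖y - x‖) (scalarPotentialDeriv g x) x := by
  simp only [div_norm_eq_regularization]
  exact isRegularization_coulomb.hasFDerivAt_integral isRegularization_coulombDeriv
    (fun ε hε z v => hasFDerivAt_coulomb hε z v) hg x

lemma IsDensity.continuous_scalarPotentialDeriv (hg : IsDensity g R M) :
    Continuous (scalarPotentialDeriv g) :=
  (isRegularization_coulombDeriv.continuous_integral_zero hg).neg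

lemma IsDensity.norm_scalarPotentialDeriv_le (hg : IsDensity g R M) (x : E3) :
    ‖scalarPotentialDeriv g x‖ ≤ 3 * M * weightBound R := by
  rw [scalarPotentialDeriv, norm_neg]
  exact isRegularization_coulombDeriv.norm_integral_le hg x

lemma IsDensity.integrable_mul_inv_norm_sq (hg : IsDensity g R M) (x : E3) :
    Integrable (fun y => |g y| * (‖y - x‖ ^ 2)⁻¹) := by
  have h := (isRegularization_coulombDeriv.integrable_zero hg x).norm
  refine h.congr ?_
  filter_upwards [ae_sub_ne_zero x] with y hy
  have hs : ‖y - x‖ ≠ 0 := norm_ne_zero_iff.2 hy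
  rw [norm_smul, norm_neg, norm_mul, innerSL_apply_norm, invDist_zero, norm_pow, norm_inv,
    norm_norm, Real.norm_eq_abs]
  field_simp

end ScalarPotential

/-! ### Gradients from derivatives -/

section Gradient

variable {φ : E3 → ℝ} {U : E3 → E3 →L[ℝ] ℝ}

lemma continuous_gradient_of_hasFDerivAt (h : ∀ x, HasFDerivAt φ (U x) x) (hU : Continuous U) :
    Continuous (gradient φ) := by
  have : gradient φ = fun x => (InnerProductSpace.toDual ℝ E3).symm (U x) := by
    ext1 x; rw [gradient, (h x).fderiv]
  rw [this]
  exact (InnerProductSpace.toDual ℝ E3).symm.continuous.comp hU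

lemma norm_gradient_of_hasFDerivAt {T : E3 →L[ℝ] ℝ} {x : E3} (h : HasFDerivAt φ T x) :
    ‖gradient φ x‖ = ‖T‖ := by
  rw [gradient, h.fderiv, LinearIsometryEquiv.norm_map]

end Gradient

/-! ### The matrix kernel of the gradient formula -/

section GradientMatrix

/-- The vector representing `v ↦ gradientMatrix ω v k i`. -/
noncomputable def gradientRow (ω : E3) (k i : Fin 3) : E3 :=
  ω k • EuclideanSpace.single i 1 - ω i • EuclideanSpace.single k 1 +
    (3 * (ω k * ω i) - (1 : Matrix (Fin 3) (Fin 3) ℝ) k i) • ω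

lemma gradientMatrix_apply (ω v : E3) (k i : Fin 3) :
    gradientMatrix ω v k i = inner ℝ (gradientRow ω k i) v := by
  simp only [gradientMatrix, gradientRow, tensor, Matrix.add_apply, Matrix.sub_apply,
    Matrix.smul_apply, Matrix.of_apply, smul_eq_mul, inner_add_left, inner_sub_left,
    real_inner_smul_left, EuclideanSpace.inner_single_left, map_one, one_mul, real_inner_comm v ω]
  ring

lemma norm_gradientRow_le {ω : E3} (hω : ‖ω‖ ≤ 1) (k i : Fin 3) : ‖gradientRow ω k i‖ ≤ 6 := by
  have hc : ∀ i, |ω i| ≤ 1 := fun i => (PiLp.norm_apply_le ω i).trans hω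
  have h1 : |(1 : Matrix (Fin 3) (Fin 3) ℝ) k i| ≤ 1 := by
    rw [Matrix.one_apply]; split_ifs <;> simp
  unfold gradientRow
  refine (norm_add_le _ _).trans ((add_le_add_left (norm_sub_le _ _) _).trans ?_)
  simp only [norm_smul, PiLp.norm_single, norm_one, mul_one, Real.norm_eq_abs]
  have h2 : |3 * (ω k * ω i) - (1 : Matrix (Fin 3) (Fin 3) ℝ) k i| ≤ 4 := by
    refine (abs_sub _ _).trans ?_
    rw [abs_mul, abs_mul, abs_of_nonneg (a := (3 : ℝ)) (by norm_num)]
    have : |ω k| * |ω i| ≤ 1 := mul_le_one₀ (hc k) (abs_nonneg _) (hc i)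
    linarith
  have h3 : |3 * (ω k * ω i) - (1 : Matrix (Fin 3) (Fin 3) ℝ) k i| * ‖ω‖ ≤ 4 * 1 := by gcongr
  linarith [hc k, hc i]

lemma norm_omega_le (x y : E3) : ‖omega x y‖ ≤ 1 := by
  rw [omega, norm_smul, norm_inv, norm_norm]
  exact inv_mul_le_one

lemma measurable_gradientRow (k i : Fin 3) : Measurable fun ω => gradientRow ω k i := by
  unfold gradientRow
  exact Continuous.measurable (by fun_prop)

/-- Substitute `z = ‖z‖ ω` in `dipoleDeriv`; the minus sign is that of differentiating `y - x` in
`x`. -/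
lemma neg_dipoleDeriv_apply_single {x y : E3} (h : y - x ≠ 0) (v : E3) (k i : Fin 3) :
    -dipoleDeriv (‖y - x‖⁻¹ ^ 3) (‖y - x‖⁻¹ ^ 5) (y - x) v (EuclideanSpace.single k 1) i =
      (‖y - x‖ ^ 2)⁻¹ * gradientMatrix (omega x y) v k i := by
  have hs : ‖y - x‖ ≠ 0 := norm_ne_zero_iff.2 h
  rw [dipoleDeriv_apply]
  simp only [gradientMatrix, tensor, omega, Matrix.add_apply, Matrix.sub_apply, Matrix.smul_apply,
    Matrix.of_apply, smul_eq_mul, PiLp.add_apply, PiLp.sub_apply, PiLp.smul_apply,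
    EuclideanSpace.inner_single_right, one_mul, conj_trivial, real_inner_smul_right,
    real_inner_comm v, Matrix.one_apply, PiLp.single_apply]
  generalize hz : y - x = z at *
  rcases eq_or_ne k i with rfl | hki
  · simp
    field_simp
    ring
  · simp [hki, hki.symm]
    field_simp
    ring

/-- The antisymmetric part has no trace, and `3 |ω|² - 3 = 0`. -/
lemma trace_gradientMatrix {ω : E3} (hω : ‖ω‖ = 1) (v : E3) :
    ∑ i, gradientMatrix ω v i i = 0 := by
  have h : ω 0 * ω 0 + ω 1 * ω 1 + ω 2 * ω 2 = 1 := by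
    have := EuclideanSpace.norm_sq_eq ω
    rw [hω, Fin.sum_univ_three] at this
    simp only [Real.norm_eq_abs, sq_abs] at this
    linarith
  simp only [gradientMatrix, tensor, Fin.sum_univ_three, Matrix.add_apply, Matrix.sub_apply,
    Matrix.smul_apply, Matrix.of_apply, smul_eq_mul, Matrix.one_apply_eq]
  linear_combination (3 * inner ℝ v ω) * h

end GradientMatrix

/-! ### Divergence and gradient formula for the vector potential -/

section Conclusion

variable {f : E3 × E3 → ℝ} {A : E3 → E3} {R L : ℝ}

/-- The functional extracting an entry of a linear map. -/
noncomputable def entry (k i : Fin 3) : (E3 →L[ℝ] E3) →L[ℝ] ℝ :=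
  (EuclideanSpace.proj i : E3 →L[ℝ] ℝ).comp
    (ContinuousLinearMap.apply ℝ E3 (EuclideanSpace.single k 1))

lemma entry_apply (k i : Fin 3) (T : E3 →L[ℝ] E3) :
    entry k i T = T (EuclideanSpace.single k 1) i := rfl

lemma abs_entry_le (k i : Fin 3) (T : E3 →L[ℝ] E3) : |entry k i T| ≤ ‖T‖ := by
  refine (PiLp.norm_apply_le (T (EuclideanSpace.single k 1)) i).trans ?_
  simpa using T.le_opNorm (EuclideanSpace.single k 1)

lemma IsVectorPotential.eq (hA : IsVectorPotential f A) :
    A = fun x => (1 / 2 : ℝ) • ∫ y, darwinKernel x y (current f A y) :=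
  funext fun x => (hA x).2

lemma IsVectorPotential.hasFDerivAt (hA : IsVectorPotential f A)
    (hd : IsDensity (current f A) R L) (x : E3) :
    HasFDerivAt A (potentialDeriv (current f A) x) x := by
  have h := hd.hasFDerivAt_potential x
  rwa [← hA.eq] at h

lemma IsVectorPotential.hasFDerivAt_component (hA : IsVectorPotential f A)
    (hd : IsDensity (current f A) R L) (i : Fin 3) (x : E3) :
    HasFDerivAt (fun y => A y i)
      ((EuclideanSpace.proj i : E3 →L[ℝ] ℝ).comp (potentialDeriv (current f A) x)) x :=
  (EuclideanSpace.proj i : E3 →L[ℝ] ℝ).hasFDerivAt.comp x (hA.hasFDerivAt hd x)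

lemma IsVectorPotential.matrixGradient_apply (hA : IsVectorPotential f A)
    (hd : IsDensity (current f A) R L) (x : E3) (k i : Fin 3) :
    matrixGradient A x k i = entry k i (potentialDeriv (current f A) x) := by
  rw [matrixGradient, Matrix.of_apply, (hA.hasFDerivAt hd x).fderiv, entry_apply]

lemma IsVectorPotential.norm_gradient_component_le (hA : IsVectorPotential f A)
    (hd : IsDensity (current f A) R L) (i : Fin 3) (x : E3) :
    ‖gradient (fun y => A y i) x‖ ≤ 24 * L * weightBound R := by
  rw [norm_gradient_of_hasFDerivAt (hA.hasFDerivAt_component hd i x)]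
  refine ContinuousLinearMap.opNorm_le_bound _ ((norm_nonneg _).trans
    (hd.norm_potentialDeriv_le x)) fun v => ?_
  refine (PiLp.norm_apply_le (potentialDeriv (current f A) x v) i).trans ?_
  refine (ContinuousLinearMap.le_opNorm _ v).trans ?_
  gcongr
  exact hd.norm_potentialDeriv_le x

lemma IsVectorPotential.divergence_eq_trace (hA : IsVectorPotential f A)
    (hd : IsDensity (current f A) R L) (x : E3) :
    divergence A x = (matrixGradient A x).trace := by
  rw [divergence, Matrix.trace]
  refine Finset.sum_congr rfl fun i _ => ?_
  rw [(hA.hasFDerivAt_component hd i x).fderiv, Matrix.diag_apply, hA.matrixGradient_apply hd]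
  rfl

/-- The integrand vanishes for every `y ≠ x`: the kernel itself is divergence free, whatever the
current. -/
lemma IsVectorPotential.trace_eq_zero (hA : IsVectorPotential f A)
    (hd : IsDensity (current f A) R L) (x : E3) : (matrixGradient A x).trace = 0 := by
  have h := hd.apply_potentialDeriv (∑ i, entry i i) x
  have h2 : (matrixGradient A x).trace =
      (∑ i, entry i i : (E3 →L[ℝ] E3) →L[ℝ] ℝ) (potentialDeriv (current f A) x) := by
    rw [Matrix.trace, sum_apply]
    exact Finset.sum_congr rfl fun i _ => hA.matrixGradient_apply hd x i i
  rw [h2, h]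
  have h3 : ∫ y, -(∑ i, entry i i : (E3 →L[ℝ] E3) →L[ℝ] ℝ)
      (dipoleDeriv (‖y - x‖⁻¹ ^ 3) (‖y - x‖⁻¹ ^ 5) (y - x) (current f A y)) =
      ∫ _ : E3, (0 : ℝ) := by
    refine integral_congr_ae ?_
    filter_upwards [ae_sub_ne_zero x] with y hy
    have hs : ‖y - x‖ ≠ 0 := norm_ne_zero_iff.2 hy
    have hω : ‖omega x y‖ = 1 := by
      rw [omega, norm_smul, norm_inv, norm_norm, inv_mul_cancel₀ hs]
    rw [sum_apply, ← Finset.sum_neg_distrib]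
    simp only [entry_apply, neg_dipoleDeriv_apply_single hy]
    rw [← Finset.mul_sum, trace_gradientMatrix hω, mul_zero]
  rw [h3, integral_zero, mul_zero]

lemma gradientIntegrand_apply (x y p : E3) (k i : Fin 3) :
    gradientIntegrand f A x y p k i =
      f (y, p) * (‖y - x‖ ^ 2)⁻¹ * inner ℝ (gradientRow (omega x y) k i) (velA A y p) := by
  rw [gradientIntegrand, Matrix.smul_apply, gradientMatrix_apply, smul_eq_mul, div_eq_mul_inv]

/-- The integrand is at most `6 |f| ‖y - x‖⁻²`, and integrating in `p` first leaves the charge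
density against an inverse square. -/
lemma IsPhaseDensity.integrable_gradientIntegrand (hf : IsPhaseDensity f R L)
    (hA : AEStronglyMeasurable A volume) (x : E3) (k i : Fin 3) :
    Integrable (fun z : E3 × E3 => gradientIntegrand f A x z.1 z.2 k i) := by
  have hw : AEStronglyMeasurable (fun z : E3 × E3 => (‖z.1 - x‖ ^ 2)⁻¹) (volume.prod volume) :=
    Measurable.aestronglyMeasurable (by fun_prop)
  have hm : AEStronglyMeasurable (fun z : E3 × E3 => ‖f z‖ * (‖z.1 - x‖ ^ 2)⁻¹)
      (volume.prod volume) := hf.integrable.aestronglyMeasurable.norm.mul hw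
  have hdom : Integrable (fun z : E3 × E3 => ‖f z‖ * (‖z.1 - x‖ ^ 2)⁻¹) (volume.prod volume) := by
    refine (integrable_prod_iff hm).2 ⟨?_, ?_⟩
    · filter_upwards [hf.fiber_integrable] with y hy
      exact hy.norm.mul_const _
    · refine (hf.isDensity_rho.integrable_mul_inv_norm_sq x).congr ?_
      filter_upwards [hf.fiber_nonneg] with y hy
      have h1 : ∫ p, ‖f (y, p)‖ = |rho f y| := by
        rw [rho, abs_of_nonneg (integral_nonneg_of_ae hy)]
        refine integral_congr_ae ?_
        filter_upwards [hy] with p hp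
        exact Real.norm_of_nonneg hp
      simp only [norm_mul, norm_norm, norm_inv, norm_pow]
      rw [integral_mul_const, h1]
  simp only [gradientIntegrand_apply]
  refine Integrable.mono' (hdom.mul_const 6) ?_ (Eventually.of_forall fun z => ?_)
  · have hrow : AEStronglyMeasurable (fun z : E3 × E3 => gradientRow (omega x z.1) k i)
        (volume.prod volume) := by
      have hω : Measurable fun z : E3 × E3 => omega x z.1 := by unfold omega; fun_prop
      exact ((measurable_gradientRow k i).comp hω).aestronglyMeasurable
    have h := (hw.mul (hrow.inner (𝕜 := ℝ) (hf.aestronglyMeasurable_smul_velA hA)))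
    refine h.congr (Eventually.of_forall fun z => ?_)
    simp only [Pi.mul_apply, real_inner_smul_right]
    ring
  · rw [norm_mul, norm_mul, norm_inv, norm_pow, norm_norm]
    gcongr
    refine (norm_inner_le_norm _ _).trans ?_
    calc _ ≤ (6 : ℝ) * 1 := by
          gcongr
          · exact norm_gradientRow_le (norm_omega_le _ _) k i
          · exact norm_vel_le_one _
      _ = 6 := mul_one _

/-- The matrix depends linearly on the velocity, so averaging over `p` replaces the velocity by the
current. -/
lemma IsPhaseDensity.integral_gradientIntegrand (hf : IsPhaseDensity f R L) (x : E3)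
    (k i : Fin 3) :
    ∀ᵐ y, ∫ p, gradientIntegrand f A x y p k i =
      (‖y - x‖ ^ 2)⁻¹ * gradientMatrix (omega x y) (current f A y) k i := by
  filter_upwards [hf.fiber_integrable] with y hy
  have hi : Integrable (fun p => f (y, p) • velA A y p) := integrable_smul_vel hy (A y)
  rw [gradientMatrix_apply, current, ← integral_inner hi, ← integral_const_mul]
  congr 1
  ext p
  rw [gradientIntegrand_apply, real_inner_smul_right]
  ring

lemma IsVectorPotential.matrixGradient_eq_integral (hA : IsVectorPotential f A)
    (hf : IsPhaseDensity f R L) (hd : IsDensity (current f A) R L) (x : E3) (k i : Fin 3) :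
    matrixGradient A x k i = 1 / 2 * ∫ y, ∫ p, gradientIntegrand f A x y p k i := by
  rw [hA.matrixGradient_apply hd, hd.apply_potentialDeriv]
  congr 1
  refine integral_congr_ae ?_
  filter_upwards [ae_sub_ne_zero x, hf.integral_gradientIntegrand x k i] with y hy h
  rw [h, entry_apply, neg_dipoleDeriv_apply_single hy]

end Conclusion

end RVD

theorem lemma3 (f : RVD.E3 × RVD.E3 → ℝ)
    (hf_Linfty : MemLp f ∞ volume)
    (hf_nonneg : ∀ᵐ z, 0 ≤ f z)
    (hf_supp : ∃ K : Set (RVD.E3 × RVD.E3), IsCompact K ∧ ∀ᵐ z, z ∉ K → f z = 0) :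
    ∃ (Φ : RVD.E3 → ℝ) (A : RVD.E3 → RVD.E3),
      -- existence and uniqueness of the bounded potentials
      RVD.IsBoundedPotentials f Φ A ∧
      (∀ Φ' A', RVD.IsBoundedPotentials f Φ' A' → Φ' = Φ ∧ A' = A) ∧
      -- bounded continuous gradients
      (Differentiable ℝ Φ ∧ Continuous (gradient Φ) ∧ ∃ C : ℝ, ∀ x, ‖gradient Φ x‖ ≤ C) ∧
      (Differentiable ℝ A ∧ Continuous (RVD.matrixGradient A) ∧
        ∃ C : ℝ, ∀ x k i, |RVD.matrixGradient A x k i| ≤ C) ∧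
      -- integrability of the force terms
      Integrable (fun z : RVD.E3 × RVD.E3 => f z • gradient Φ z.1) ∧
      Integrable (fun z : RVD.E3 × RVD.E3 =>
        f z • ∑ i, RVD.velA A z.1 z.2 i • gradient (fun y => A y i) z.1) ∧
      -- zero divergence
      (∀ x, RVD.divergence A x = (RVD.matrixGradient A x).trace ∧
        (RVD.matrixGradient A x).trace = 0) ∧
      -- formula for the matrix gradient
      (∀ x k i,
        Integrable (fun z : RVD.E3 × RVD.E3 => RVD.gradientIntegrand f A x z.1 z.2 k i) ∧
        RVD.matrixGradient A x k i =
          (1 / 2 : ℝ) * ∫ y, ∫ p, RVD.gradientIntegrand f A x y p k i) := by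
  obtain ⟨R, L, hf⟩ := RVD.exists_isPhaseDensity hf_Linfty hf_nonneg hf_supp
  obtain ⟨A, hA, hd⟩ := hf.exists_isVectorPotential
  have hρ := hf.isDensity_rho
  have hΦ' := hρ.hasFDerivAt_scalarPotential
  have hA' := hA.hasFDerivAt hd
  have hAc : Continuous A := continuous_iff_continuousAt.2 fun x => (hA' x).continuousAt
  have hΦc := RVD.continuous_gradient_of_hasFDerivAt hΦ' hρ.continuous_scalarPotentialDeriv
  have hΦb : ∀ x, ‖gradient (fun x => ∫ y, RVD.rho f y / ‖y - x‖) x‖ ≤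
      3 * L * RVD.weightBound R := fun x => by
    rw [RVD.norm_gradient_of_hasFDerivAt (hΦ' x)]
    exact hρ.norm_scalarPotentialDeriv_le x
  refine ⟨fun x => ∫ y, RVD.rho f y / ‖y - x‖, A,
    ⟨fun x => ⟨hρ.integrable_div_norm x, rfl⟩, hA, ⟨_, hρ.abs_scalarPotential_le⟩,
      ⟨4 * L * RVD.weightBound R, fun x => ?_⟩⟩,
    fun Φ₁ A₁ h => ⟨funext fun x => (h.scalar x).2, hf.isVectorPotential_unique hA h.vector⟩,
    ⟨fun x => (hΦ' x).differentiableAt, hΦc, _, hΦb⟩,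
    ⟨fun x => (hA' x).differentiableAt, ?_, 24 * L * RVD.weightBound R, fun x k i => ?_⟩,
    ?_, ?_, fun x => ⟨hA.divergence_eq_trace hd x, hA.trace_eq_zero hd x⟩,
    fun x k i => ⟨hf.integrable_gradientIntegrand hAc.aestronglyMeasurable x k i,
      hA.matrixGradient_eq_integral hf hd x k i⟩⟩
  · rw [(hA x).2]; exact hd.norm_potential_le x
  · refine continuous_matrix fun k i => ?_
    simp only [hA.matrixGradient_apply hd]
    exact (RVD.entry k i).continuous.comp hd.continuous_potentialDeriv
  · rw [hA.matrixGradient_apply hd]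
    exact (RVD.abs_entry_le k i _).trans (hd.norm_potentialDeriv_le x)
  · refine Integrable.mono' (hf.integrable.norm.mul_const (3 * L * RVD.weightBound R)) ?_
      (Filter.Eventually.of_forall fun z => ?_)
    · exact hf.integrable.aestronglyMeasurable.smul (hΦc.comp continuous_fst).aestronglyMeasurable
    · rw [norm_smul]
      gcongr
      exact hΦb z.1
  · have hg : ∀ i, Continuous (gradient fun y => A y i) := fun i =>
      RVD.continuous_gradient_of_hasFDerivAt (hA.hasFDerivAt_component hd i)
        (continuous_const.clm_comp hd.continuous_potentialDeriv)
    have hv : Continuous fun z : RVD.E3 × RVD.E3 => RVD.velA A z.1 z.2 :=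
      RVD.continuous_vel.comp (continuous_snd.sub (hAc.comp continuous_fst))
    refine Integrable.mono' (hf.integrable.norm.mul_const
      (∑ _i : Fin 3, 24 * L * RVD.weightBound R)) ?_ (Filter.Eventually.of_forall fun z => ?_)
    · refine hf.integrable.aestronglyMeasurable.smul (Continuous.aestronglyMeasurable ?_)
      refine continuous_finsetSum _ fun i _ => ?_
      have h1 : Continuous fun z : RVD.E3 × RVD.E3 => RVD.velA A z.1 z.2 i :=
        (EuclideanSpace.proj i : RVD.E3 →L[ℝ] ℝ).continuous.comp hv
      have h2 : Continuous fun z : RVD.E3 × RVD.E3 => gradient (fun y => A y i) z.1 :=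
        (hg i).comp continuous_fst
      exact h1.smul h2
    · rw [norm_smul]
      gcongr
      refine norm_sum_le_of_le _ fun i _ => ?_
      rw [norm_smul]
      have h1 : ‖RVD.velA A z.1 z.2 i‖ ≤ 1 :=
        (PiLp.norm_apply_le _ i).trans (RVD.norm_vel_le_one _)
      calc _ ≤ 1 * (24 * L * RVD.weightBound R) := by
            gcongr
            exact hA.norm_gradient_component_le hd i z.1
        _ = _ := one_mul _
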